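/- All matroids are finite. The free product of matroids $M=M(S)$ and $N=N(T)$ (with $S,T$ disjoint) is the matroid $M\mathbin{\Box}N$ on $S\cup T$ whose independent sets are the $A\subseteq S\cup T$ such that $A\cap S$ is independent in $M$ and $\rho(M)-\rho_M(A\cap S)\ge |A\cap T|-\rho_N(A\cap T)$, where $\rho$ denotes rank. A nonempty matroid $M$ is irreducible if $M\cong P\mathbin{\Box}Q$ implies $M\cong P$ or $M\cong Q$; the empty matroid is not irreducible. Let $\mathcal M$ be a nonempty family of matroids, closed under isomorphism, minors and free products, and let $K$ be a field of characteristic zero. Let $K\{\mathcal M\}$ be the minor coalgebra of $\mathcal M$: the $K$-vector space with basis the isomorphism classes of matroids in $\mathcal M$, with coproduct $\delta(M)=\sum_{A\subseteq S} M|A\otimes M/A$ for $M=M(S)$, and counit $\epsilon(M)=1$ if $S=\emptyset$ and $\epsilon(M)=0$ otherwise. It is bigraded by rank and nullity. Let $K\{\mathcal M\}^*$ be the minor algebra, that is, the graded dual of $K\{\mathcal M\}$ (the linear functionals vanishing on all but finitely many bihomogeneous components), with the convolution product dual to $\delta$ and unit $\epsilon$. Identify each isomorphism class of matroids in $\mathcal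 M$ with the corresponding dual basis element of $K\{\mathcal M\}^*$, so that $$M\cdot N=\sum_{L\in\mathcal M}\#\{A\subseteq U : L=L(U),\ L|A\cong M,\ L/A\cong N\}\,L .$$ Then $K\{\mathcal M\}^*$ is the free associative unital $K$-algebra generated by the set of (isomorphism classes of) irreducible matroids belonging to $\mathcal M$: the canonical algebra homomorphism from the free associative algebra on this set to $K\{\mathcal M\}^*$, sending each irreducible class to its dual basis element, is an isomorphism. -/

import Mathlib

open scoped TensorProduct Matroid

universe u v w

noncomputable section

namespace MatroidMinor

section Basic

variable {α : Type u} {β : Type v}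

/-- The rank `ρ_M(A)` of a subset of a finite matroid, as a natural number. -/
def rk (M : Matroid α) (A : Set α) : ℕ := (M.eRk A).toNat

/-- The nullity `ν_M(A) = |A| - ρ_M(A)`; the subtraction does not truncate, as `ρ_M(A) ≤ |A|`
for finite `A`. -/
def nul (M : Matroid α) (A : Set α) : ℕ := A.ncard - rk M A

/-- The rank-lack `λ_M(A) = ρ(M) - ρ_M(A)`; the subtraction does not truncate. -/
def rankLack (M : Matroid α) (A : Set α) : ℕ := rk M M.E - rk M A

theorem rk_eq_ncard {M : Matroid α} {A : Set α} (h : M.Indep A) : rk M A = A.ncard := by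
  rw [rk, h.eRk_eq_encard, Set.ncard]

theorem coe_rk (M : Matroid α) [M.Finite] (A : Set α) : (rk M A : ℕ∞) = M.eRk A :=
  ENat.natCast_toNat (Matroid.eRk_ne_top_iff.2 (M.isRkFinite_set A))

theorem rk_mono (M : Matroid α) [M.Finite] {A B : Set α} (h : A ⊆ B) : rk M A ≤ rk M B := by
  have := M.eRk_mono h
  rw [← coe_rk, ← coe_rk] at this
  exact_mod_cast this

theorem rk_le_rk_ground (M : Matroid α) [M.Finite] (A : Set α) : rk M A ≤ rk M M.E := by
  have := M.eRk_le_eRank A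
  rw [← M.eRk_ground, ← coe_rk, ← coe_rk] at this
  exact_mod_cast this

theorem rk_le_ncard (M : Matroid α) [M.Finite] {A : Set α} (hA : A.Finite) :
    rk M A ≤ A.ncard := by
  have := M.eRk_le_encard A
  rw [← coe_rk, ← hA.cast_ncard_eq] at this
  exact_mod_cast this

theorem rk_union_le (M : Matroid α) [M.Finite] (A : Set α) {B : Set α} (hB : B.Finite) :
    rk M (A ∪ B) ≤ rk M A + B.ncard := by
  have := M.eRk_union_le_eRk_add_encard A B
  rw [← coe_rk, ← coe_rk, ← hB.cast_ncard_eq] at this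
  exact_mod_cast this

theorem ncard_sum {A : Set (α ⊕ β)} (hA : A.Finite) :
    A.ncard = (Sum.inl ⁻¹' A).ncard + (Sum.inr ⁻¹' A).ncard := by
  have h1 : (Sum.inl ⁻¹' A).Finite := hA.preimage Sum.inl_injective.injOn
  have h2 : (Sum.inr ⁻¹' A).Finite := hA.preimage Sum.inr_injective.injOn
  conv_lhs => rw [← Set.image_preimage_inl_union_image_preimage_inr A]
  rw [Set.ncard_union_eq _ (h1.image _) (h2.image _),
    Set.ncard_image_of_injective _ Sum.inl_injective,
    Set.ncard_image_of_injective _ Sum.inr_injective]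
  rw [Set.disjoint_left]
  rintro _ ⟨a, _, rfl⟩ ⟨b, _, h⟩
  exact absurd h (by simp)

/-- The independent sets of the free product of `M` and `N`: the subsets `A` of the disjoint
union of the ground sets `S` of `M` and `T` of `N` such that `A ∩ S` is independent in `M`
and `λ_M(A ∩ S) ≥ ν_N(A ∩ T)`. -/
def FreeIndep (M : Matroid α) (N : Matroid β) (A : Set (α ⊕ β)) : Prop :=
  A ⊆ Sum.inl '' M.E ∪ Sum.inr '' N.E ∧ M.Indep (Sum.inl ⁻¹' A) ∧
    nul N (Sum.inr ⁻¹' A) ≤ rankLack M (Sum.inl ⁻¹' A)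

theorem ground_sum_finite (M : Matroid α) (N : Matroid β) [M.Finite] [N.Finite] :
    (Sum.inl '' M.E ∪ Sum.inr '' N.E : Set (α ⊕ β)).Finite :=
  (M.ground_finite.image _).union (N.ground_finite.image _)

theorem freeIndep_iff (M : Matroid α) (N : Matroid β) [M.Finite] [N.Finite] (A : Set (α ⊕ β)) :
    FreeIndep M N A ↔ A ⊆ Sum.inl '' M.E ∪ Sum.inr '' N.E ∧ M.Indep (Sum.inl ⁻¹' A) ∧
      A.ncard ≤ rk M M.E + rk N (Sum.inr ⁻¹' A) := by
  refine and_congr_right fun hA => and_congr_right fun hi => ?_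
  have hf := (ground_sum_finite M N).subset hA
  have h1 := rk_eq_ncard hi
  have h2 := rk_le_ncard N (hf.preimage (f := Sum.inr) Sum.inr_injective.injOn)
  have h3 := rk_le_rk_ground M (Sum.inl ⁻¹' A)
  have h4 := ncard_sum hf
  unfold nul rankLack
  omega

/-- The free product of two finite matroids, on the disjoint union of the ground sets. -/
def freeProduct (M : Matroid α) (N : Matroid β) [M.Finite] [N.Finite] : Matroid (α ⊕ β) :=
  (IndepMatroid.ofFinite (ground_sum_finite M N) (FreeIndep M N)
    (by
      rw [freeIndep_iff]
      simp)
    (by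
      intro I J hJ hIJ
      rw [freeIndep_iff] at hJ ⊢
      have hJf := (ground_sum_finite M N).subset hJ.1
      refine ⟨hIJ.trans hJ.1, hJ.2.1.subset (Set.preimage_mono hIJ), ?_⟩
      have h1 := ncard_sum hJf
      have h2 := ncard_sum (hJf.subset hIJ)
      have hl : (Sum.inl ⁻¹' I : Set α).ncard ≤ (Sum.inl ⁻¹' J : Set α).ncard :=
        Set.ncard_le_ncard (Set.preimage_mono hIJ) (hJf.preimage Sum.inl_injective.injOn)
      have hJr : (Sum.inr ⁻¹' J : Set β).Finite := hJf.preimage Sum.inr_injective.injOn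
      have hIJr : (Sum.inr ⁻¹' I : Set β) ⊆ Sum.inr ⁻¹' J := Set.preimage_mono hIJ
      have h3 := rk_union_le N (Sum.inr ⁻¹' I) (hJr.sdiff (t := Sum.inr ⁻¹' I))
      rw [Set.union_sdiff_cancel hIJr] at h3
      have h4 := Set.ncard_sdiff_add_ncard_of_subset hIJr hJr
      have h5 := hJ.2.2
      omega)
    (by
      intro I J hI hJ hlt
      simp only [freeIndep_iff] at hI hJ ⊢
      have hIf := (ground_sum_finite M N).subset hI.1
      have hJf := (ground_sum_finite M N).subset hJ.1
      have hIr : (Sum.inr ⁻¹' I : Set β).Finite := hIf.preimage Sum.inr_injective.injOn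
      have hIl : (Sum.inl ⁻¹' I : Set α).Finite := hIf.preimage Sum.inl_injective.injOn
      have hJl : (Sum.inl ⁻¹' J : Set α).Finite := hJf.preimage Sum.inl_injective.injOn
      have c1 := ncard_sum hIf
      have c2 := ncard_sum hJf
      have key : ∀ b, Sum.inr b ∈ J → Sum.inr b ∉ I →
          I.ncard + 1 ≤ rk M M.E + rk N (insert b (Sum.inr ⁻¹' I)) →
          ∃ e ∈ J, e ∉ I ∧ insert e I ⊆ Sum.inl '' M.E ∪ Sum.inr '' N.E ∧
            M.Indep (Sum.inl ⁻¹' (insert e I)) ∧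
            (insert e I).ncard ≤ rk M M.E + rk N (Sum.inr ⁻¹' (insert e I)) := by
        intro b hbJ hbI hle
        refine ⟨Sum.inr b, hbJ, hbI, Set.insert_subset (hJ.1 hbJ) hI.1, ?_, ?_⟩
        · convert hI.2.1 using 1
          ext x; simp
        · rw [Set.ncard_insert_of_notMem hbI (hs := hIf)]
          convert hle using 3
          ext x; simp
      rcases Nat.lt_or_ge (rk N (Sum.inr ⁻¹' I)) (rk N (Sum.inr ⁻¹' J)) with hr | hr
      · have hr' : N.eRk (Sum.inr ⁻¹' I) < N.eRk (Sum.inr ⁻¹' J) := by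
          rw [← coe_rk, ← coe_rk]; exact_mod_cast hr
        obtain ⟨b, ⟨hbJ, hbI⟩, hb⟩ := Matroid.exists_eRk_insert_eq_add_one_of_lt hr'
        rw [← coe_rk, ← coe_rk] at hb
        have hb' : rk N (insert b (Sum.inr ⁻¹' I)) = rk N (Sum.inr ⁻¹' I) + 1 := by
          exact_mod_cast hb
        refine key b hbJ hbI ?_
        have := hI.2.2
        omega
      · have hslack : I.ncard + 1 ≤ rk M M.E + rk N (Sum.inr ⁻¹' I) := by
          have := hJ.2.2
          omega
        rcases Nat.lt_or_ge (Sum.inl ⁻¹' I : Set α).ncard (Sum.inl ⁻¹' J : Set α).ncard with hl | hl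
        · obtain ⟨a, ⟨haJ, haI⟩, ha⟩ := hI.2.1.augment hJ.2.1 (by
            rw [← hIl.cast_ncard_eq, ← hJl.cast_ncard_eq]; exact_mod_cast hl)
          refine ⟨Sum.inl a, haJ, haI, Set.insert_subset (hJ.1 haJ) hI.1, ?_, ?_⟩
          · convert ha using 1
            ext x; simp
          · rw [Set.ncard_insert_of_notMem (show Sum.inl a ∉ I from haI) (hs := hIf)]
            convert hslack using 3
            ext x; simp
        · have hlt' : (Sum.inr ⁻¹' I : Set β).ncard < (Sum.inr ⁻¹' J : Set β).ncard := by omega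
          obtain ⟨b, hbJ, hbI⟩ := Set.exists_mem_notMem_of_ncard_lt_ncard hlt' hIr
          exact key b hbJ hbI (hslack.trans
            (Nat.add_le_add_left (rk_mono N (Set.subset_insert _ _)) _)))
    (fun _ h => h.1)).matroid

@[simp] theorem freeProduct_ground (M : Matroid α) (N : Matroid β) [M.Finite] [N.Finite] :
    (freeProduct M N).E = Sum.inl '' M.E ∪ Sum.inr '' N.E := rfl

@[simp] theorem freeProduct_indep (M : Matroid α) (N : Matroid β) [M.Finite] [N.Finite]
    (A : Set (α ⊕ β)) : (freeProduct M N).Indep A ↔ FreeIndep M N A := Iff.rfl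

instance freeProduct_finite (M : Matroid α) (N : Matroid β) [M.Finite] [N.Finite] :
    (freeProduct M N).Finite := ⟨ground_sum_finite M N⟩

/-- Two matroids are isomorphic if some bijection of their ground sets preserves
independence in both directions. -/
def Iso (M : Matroid α) (N : Matroid β) : Prop :=
  ∃ e : M.E ≃ N.E, ∀ I : Set M.E,
    M.Indep (Subtype.val '' I) ↔ N.Indep (Subtype.val '' (e '' I))

theorem Iso.refl (M : Matroid α) : Iso M M := ⟨Equiv.refl _, fun I => by simp⟩

theorem Iso.symm {M : Matroid α} {N : Matroid β} (h : Iso M N) : Iso N M := by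
  obtain ⟨e, he⟩ := h
  refine ⟨e.symm, fun I => ?_⟩
  rw [he, Equiv.image_symm_image]

theorem Iso.trans {γ : Type w} {M : Matroid α} {N : Matroid β} {L : Matroid γ}
    (h : Iso M N) (h' : Iso N L) : Iso M L := by
  obtain ⟨e, he⟩ := h
  obtain ⟨f, hf⟩ := h'
  refine ⟨e.trans f, fun I => ?_⟩
  rw [he, hf, Equiv.coe_trans, Set.image_comp]

theorem iso_map (M : Matroid α) (f : α → β) (hf : Set.InjOn f M.E) : Iso M (M.map f hf) := by
  refine ⟨Equiv.Set.imageOfInjOn f M.E hf, fun I => ?_⟩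
  have h : (Subtype.val '' ((Equiv.Set.imageOfInjOn f M.E hf) '' I) : Set β)
      = f '' (Subtype.val '' I) := by
    rw [Set.image_image, Set.image_image]; rfl
  rw [Matroid.map_indep_iff]
  refine ⟨fun h' => ⟨_, h', h⟩, ?_⟩
  rintro ⟨J, hJ, hJI⟩
  have := (h.symm.trans hJI : f '' (Subtype.val '' I) = f '' J)
  rw [hf.image_eq_image_iff (by simp) hJ.subset_ground] at this
  rwa [this]

theorem iso_of_empty {M : Matroid α} {N : Matroid β} (hM : M.E = ∅) (hN : N.E = ∅) :
    Iso M N := by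
  have : IsEmpty M.E := Set.isEmpty_coe_sort.2 hM
  have : IsEmpty N.E := Set.isEmpty_coe_sort.2 hN
  refine ⟨Equiv.equivOfIsEmpty _ _, fun I => ?_⟩
  simp [Set.eq_empty_of_isEmpty I]

theorem Iso.exists_map {M : Matroid α} {N : Matroid β} (h : Iso M N) (hN : N.E.Nonempty) :
    ∃ (f : α → β) (hf : Set.InjOn f M.E), N = M.map f hf := by
  classical
  obtain ⟨e, he⟩ := h
  obtain ⟨b, -⟩ := hN
  set f : α → β := fun a => if h : a ∈ M.E then (e ⟨a, h⟩ : β) else b with hfdef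
  have hfv : ∀ a : M.E, f a = e a := fun a => by simp [hfdef]
  have hf : Set.InjOn f M.E := by
    intro x hx y hy hxy
    have := (hfv ⟨x, hx⟩).symm.trans (hxy.trans (hfv ⟨y, hy⟩))
    simpa using e.injective (Subtype.val_injective this)
  have himg : ∀ I : Set M.E, f '' (Subtype.val '' I) = Subtype.val '' (e '' I) := by
    intro I
    rw [Set.image_image, Set.image_image]
    exact Set.image_congr fun a _ => hfv a
  have hE : N.E = f '' M.E := by
    have := himg Set.univ
    simpa using this.symm
  refine ⟨f, hf, Matroid.ext_indep (by simpa using hE) fun I hI => ?_⟩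
  obtain ⟨I', rfl⟩ : ∃ I' : Set M.E, I = Subtype.val '' (e '' I') := by
    refine ⟨e ⁻¹' (Subtype.val ⁻¹' I), ?_⟩
    rw [Equiv.image_preimage, Subtype.image_preimage_coe, Set.inter_eq_self_of_subset_right hI]
  rw [← he, Matroid.map_indep_iff]
  refine ⟨fun h' => ⟨_, h', (himg I').symm⟩, ?_⟩
  rintro ⟨J, hJ, hJI⟩
  have := (himg I').trans hJI
  rw [hf.image_eq_image_iff (by simp) hJ.subset_ground] at this
  rwa [this]

theorem Iso.ground_eq_empty {M : Matroid α} {N : Matroid β} (h : Iso M N) :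
    N.E = ∅ ↔ M.E = ∅ := by
  obtain ⟨e, -⟩ := h
  rw [← Set.isEmpty_coe_sort, ← Set.isEmpty_coe_sort]
  exact e.symm.isEmpty_congr

theorem map_restrict (M : Matroid α) (f : α → β) (hf : Set.InjOn f M.E) {A : Set α}
    (hA : A ⊆ M.E) :
    M.map f hf ↾ (f '' A) = (M ↾ A).map f (hf.mono hA) := by
  refine Matroid.ext_indep rfl fun I (hI : I ⊆ f '' A) => ?_
  simp only [Matroid.restrict_indep_iff, Matroid.map_indep_iff]
  constructor
  · rintro ⟨⟨J, hJ, rfl⟩, h⟩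
    exact ⟨J, ⟨hJ, (hf.image_subset_image_iff hJ.subset_ground hA).1 h⟩, rfl⟩
  · rintro ⟨J, ⟨hJ, hJA⟩, rfl⟩
    exact ⟨⟨J, hJ, rfl⟩, Set.image_mono hJA⟩

theorem map_contract (M : Matroid α) (f : α → β) (hf : Set.InjOn f M.E) {A : Set α}
    (hA : A ⊆ M.E) :
    (M.map f hf) ／ (f '' A) = (M ／ A).map f (hf.mono Set.sdiff_subset) := by
  have h1 : (M.map f hf) ／ (f '' A) = ((M.map f hf)✶ ↾ (f '' M.E \ f '' A))✶ := rfl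
  have h2 : (M✶.map f hf) ↾ (f '' (M.E \ A)) = (M✶ ↾ (M.E \ A)).map f (hf.mono Set.sdiff_subset) :=
    map_restrict M✶ f hf Set.sdiff_subset
  rw [h1, Matroid.map_dual, ← hf.image_sdiff_subset hA, h2, Matroid.map_dual]
  rfl

theorem Iso.exists_equiv {M : Matroid α} {N : Matroid β} (h : Iso M N) :
    ∃ φ : 𝒫 M.E ≃ 𝒫 N.E, ∀ A : 𝒫 M.E,
      Iso (M ↾ (A : Set α)) (N ↾ (φ A : Set β)) ∧ Iso (M ／ (A : Set α)) (N ／ (φ A : Set β)) := by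
  rcases N.E.eq_empty_or_nonempty with hN | hN
  · have hM := h.ground_eq_empty.1 hN
    have hM' : Unique (𝒫 M.E) := by rw [hM, Set.powerset_empty]; infer_instance
    have hN' : Unique (𝒫 N.E) := by rw [hN, Set.powerset_empty]; infer_instance
    refine ⟨Equiv.ofUnique _ _, fun A => ⟨iso_of_empty ?_ ?_, iso_of_empty ?_ ?_⟩⟩
    · exact Set.subset_empty_iff.1 (hM ▸ A.2)
    · exact Set.subset_empty_iff.1
        ((show _ ⊆ N.E from (Equiv.ofUnique (𝒫 M.E) (𝒫 N.E) A).2).trans hN.subset)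
    · simp [hM]
    · simp [hN]
  · obtain ⟨f, hf, rfl⟩ := h.exists_map hN
    refine ⟨Equiv.ofBijective (fun A => ⟨f '' (A : Set α), Set.image_mono A.2⟩) ⟨?_, ?_⟩, ?_⟩
    · intro A B hAB
      have : f '' (A : Set α) = f '' (B : Set α) := congrArg Subtype.val hAB
      exact Subtype.ext ((hf.image_eq_image_iff A.2 B.2).1 this)
    · rintro ⟨B, hB⟩
      obtain ⟨A, hA, rfl⟩ := Set.subset_image_iff.1 (show B ⊆ f '' M.E from hB)
      exact ⟨⟨A, hA⟩, rfl⟩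
    · intro A
      change Iso _ (M.map f hf ↾ (f '' (A : Set α))) ∧ Iso _ (M.map f hf ／ (f '' (A : Set α)))
      rw [map_restrict _ _ _ A.2, map_contract _ _ _ A.2]
      exact ⟨iso_map _ _ _, iso_map _ _ _⟩

theorem Iso.rk_eq {M : Matroid α} {N : Matroid β} (h : Iso M N) : rk M M.E = rk N N.E := by
  rcases N.E.eq_empty_or_nonempty with hN | hN
  · rw [hN, h.ground_eq_empty.1 hN]; simp [rk]
  · obtain ⟨f, hf, rfl⟩ := h.exists_map hN
    rw [rk, rk, Matroid.eRk_ground, Matroid.eRk_ground, Matroid.eRank_map]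

theorem Iso.nul_eq {M : Matroid α} {N : Matroid β} (h : Iso M N) : nul M M.E = nul N N.E := by
  unfold nul
  rw [h.rk_eq]
  obtain ⟨e, -⟩ := h
  rw [← Nat.card_coe_set_eq, ← Nat.card_coe_set_eq, Nat.card_congr e]

theorem rk_restrict_add_rk_contract (M : Matroid α) [M.Finite] {A : Set α} (hA : A ⊆ M.E) :
    rk (M ↾ A) A + rk (M ／ A) (M.E \ A) = rk M M.E := by
  obtain ⟨I, hI⟩ := M.exists_isBasis A
  obtain ⟨B, hB, hIB⟩ := hI.indep.exists_isBase_superset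
  have hBf : B.Finite := hB.finite
  have hIA : I = B ∩ A :=
    hI.eq_of_subset_indep (hB.indep.subset Set.inter_subset_left)
      (Set.subset_inter hIB hI.subset) Set.inter_subset_right
  have hBA : B \ I = B \ A := by rw [hIA, Set.sdiff_self_inter]
  have h1 : (M ／ A).IsBasis (B \ I) (M.E \ A) := by
    rw [hBA]
    exact hB.isBasis_ground.contract_isBasis hI
      (hB.indep.subset (Set.union_subset Set.sdiff_subset hIB))
  have h2 : rk (M ↾ A) A = I.ncard := by
    rw [rk, Matroid.restrict_eRk_eq _ subset_rfl, hI.eRk_eq_encard, Set.ncard]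
  have h3 : rk (M ／ A) (M.E \ A) = (B \ I).ncard := by rw [rk, h1.eRk_eq_encard, Set.ncard]
  have h4 : rk M M.E = B.ncard := by rw [rk, M.eRk_ground, ← hB.encard_eq_eRank, Set.ncard]
  rw [h2, h3, h4, add_comm]
  exact Set.ncard_sdiff_add_ncard_of_subset hIB hBf

end Basic

/-- A finite matroid. -/
structure FinMatroid : Type (u + 1) where
  /-- the type in which the ground set lives -/
  carrier : Type u
  /-- the matroid; its ground set `matroid.E` is a subset of `carrier` -/
  matroid : Matroid carrier
  /-- the ground set is finite -/
  finite : matroid.Finite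

instance (M : FinMatroid.{u}) : M.matroid.Finite := M.finite

instance (M : FinMatroid.{u}) : Finite (𝒫 M.matroid.E) :=
  M.matroid.ground_finite.finite_subsets.to_subtype

instance (M : FinMatroid.{u}) : Fintype (𝒫 M.matroid.E) := Fintype.ofFinite _

namespace FinMatroid

/-- The ground set of a finite matroid. -/
abbrev E (M : FinMatroid.{u}) : Set M.carrier := M.matroid.E

/-- The restriction `M|A`, for a subset `A` of the ground set. -/
def restrict (M : FinMatroid.{u}) (A : 𝒫 M.E) : FinMatroid.{u} :=
  ⟨M.carrier, M.matroid ↾ (A : Set M.carrier),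
    Matroid.restrict_finite (M.matroid.ground_finite.subset A.2)⟩

/-- The contraction `M/A`, a matroid on the complement of `A`, for a subset `A` of the
ground set. -/
def contract (M : FinMatroid.{u}) (A : 𝒫 M.E) : FinMatroid.{u} :=
  ⟨M.carrier, M.matroid ／ (A : Set M.carrier), inferInstance⟩

/-- The free product. -/
def freeProd (M N : FinMatroid.{u}) : FinMatroid.{u} :=
  ⟨M.carrier ⊕ N.carrier, freeProduct M.matroid N.matroid, inferInstance⟩

/-- The empty matroid. -/
def empty : FinMatroid.{u} := ⟨PEmpty, Matroid.emptyOn PEmpty, ⟨Set.finite_empty⟩⟩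

instance setoid : Setoid FinMatroid.{u} where
  r M N := Iso M.matroid N.matroid
  iseqv := ⟨fun _ => Iso.refl _, Iso.symm, Iso.trans⟩

end FinMatroid

/-- Isomorphism classes of finite matroids. -/
def MatroidClass : Type (u + 1) := Quotient FinMatroid.setoid.{u}

/-- The isomorphism class of a finite matroid. -/
def FinMatroid.cls (M : FinMatroid.{u}) : MatroidClass.{u} := Quotient.mk _ M

theorem FinMatroid.cls_eq_iff {M N : FinMatroid.{u}} :
    M.cls = N.cls ↔ Iso M.matroid N.matroid := Quotient.eq

theorem FinMatroid.cls_eq_empty_iff {M : FinMatroid.{u}} :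
    M.cls = FinMatroid.empty.cls ↔ M.E = ∅ := by
  rw [cls_eq_iff]
  exact ⟨fun h => h.ground_eq_empty.1 rfl, fun h => iso_of_empty h rfl⟩

namespace MatroidClass

/-- A chosen matroid in an isomorphism class. -/
def repr (c : MatroidClass.{u}) : FinMatroid.{u} := Quotient.out c

theorem repr_cls (c : MatroidClass.{u}) : c.repr.cls = c := Quotient.out_eq c

/-- The rank of an isomorphism class of matroids. -/
def rank : MatroidClass.{u} → ℕ :=
  Quotient.lift (fun M : FinMatroid.{u} => rk M.matroid M.E) fun _ _ h => Iso.rk_eq h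

/-- The nullity of an isomorphism class of matroids. -/
def nullity : MatroidClass.{u} → ℕ :=
  Quotient.lift (fun M : FinMatroid.{u} => nul M.matroid M.E) fun _ _ h => Iso.nul_eq h

/-- A matroid is irreducible if it is nonempty and every factorization of it as a free product
contains it as a factor. -/
def IsIrreducible (c : MatroidClass.{u}) : Prop :=
  c ≠ FinMatroid.empty.cls ∧
    ∀ P Q : FinMatroid.{u}, c = (P.freeProd Q).cls → c = P.cls ∨ c = Q.cls

end MatroidClass

/-- A family of matroids (as a set of isomorphism classes) is closed under minors. -/
def MinorClosed (𝓜 : Set MatroidClass.{u}) : Prop :=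
  ∀ (α : Type u) (M N : Matroid α) (hM : M.Finite) (hN : N.Finite), N ≤m M →
    (FinMatroid.mk α M hM).cls ∈ 𝓜 → (FinMatroid.mk α N hN).cls ∈ 𝓜

/-- A family of matroids (as a set of isomorphism classes) is closed under free products. -/
def FreeProductClosed (𝓜 : Set MatroidClass.{u}) : Prop :=
  ∀ M N : FinMatroid.{u}, M.cls ∈ 𝓜 → N.cls ∈ 𝓜 → (M.freeProd N).cls ∈ 𝓜

theorem MinorClosed.restrict {𝓜 : Set MatroidClass.{u}} (h : MinorClosed 𝓜) {M : FinMatroid.{u}}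
    (hM : M.cls ∈ 𝓜) (A : 𝒫 M.E) : (M.restrict A).cls ∈ 𝓜 :=
  h _ M.matroid _ M.finite _
    ⟨∅, M.E \ A, by
      rw [Matroid.contract_empty, Matroid.delete, Set.sdiff_sdiff_cancel_left A.2]⟩ hM

theorem MinorClosed.contract {𝓜 : Set MatroidClass.{u}} (h : MinorClosed 𝓜) {M : FinMatroid.{u}}
    (hM : M.cls ∈ 𝓜) (A : 𝒫 M.E) : (M.contract A).cls ∈ 𝓜 :=
  h _ M.matroid _ M.finite _ ⟨A, ∅, by simp⟩ hM

section Coalgebra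

variable (K : Type v) [CommRing K] {𝓜 : Set MatroidClass.{u}} (h : MinorClosed 𝓜)

/-- The underlying module of the minor coalgebra of a minor-closed family: the free module on
the isomorphism classes of matroids in the family. -/
def MinorCoalgebra (_h : MinorClosed 𝓜) : Type (max (u + 1) v) := 𝓜 →₀ K

instance : AddCommGroup (MinorCoalgebra K h) := inferInstanceAs (AddCommGroup (𝓜 →₀ K))

instance : Module K (MinorCoalgebra K h) := inferInstanceAs (Module K (𝓜 →₀ K))

/-- The basis vector of an isomorphism class. -/
def vec (c : 𝓜) : MinorCoalgebra K h := Finsupp.single c 1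

/-- The linear map with prescribed values on the basis of isomorphism classes. -/
def lin {V : Type w} [AddCommGroup V] [Module K V] (f : 𝓜 → V) : MinorCoalgebra K h →ₗ[K] V :=
  Finsupp.linearCombination K f

theorem lin_vec {V : Type w} [AddCommGroup V] [Module K V] (f : 𝓜 → V) (c : 𝓜) :
    lin K h f (vec K h c) = f c := by
  exact (Finsupp.linearCombination_single K (1 : K) c).trans (one_smul K _)

theorem lin_ext {V : Type w} [AddCommMonoid V] [Module K V] {f g : MinorCoalgebra K h →ₗ[K] V}
    (hfg : ∀ (M : FinMatroid.{u}) (hM : M.cls ∈ 𝓜), f (vec K h ⟨_, hM⟩) = g (vec K h ⟨_, hM⟩)) :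
    f = g := by
  refine Finsupp.lhom_ext' fun c => LinearMap.ext_ring ?_
  obtain ⟨c, hc⟩ := c
  obtain ⟨M, rfl⟩ := Quotient.exists_rep c
  exact hfg M hc

/-- The element `∑_{A ⊆ S} M|A ⊗ M/A`, for a matroid `M = M(S)` in the family. -/
def coprod (M : FinMatroid.{u}) (hM : M.cls ∈ 𝓜) : MinorCoalgebra K h ⊗[K] MinorCoalgebra K h :=
  ∑ A : 𝒫 M.E, vec K h ⟨(M.restrict A).cls, h.restrict hM A⟩ ⊗ₜ[K]
    vec K h ⟨(M.contract A).cls, h.contract hM A⟩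

theorem coprod_congr {M N : FinMatroid.{u}} (hM : M.cls ∈ 𝓜) (hN : N.cls ∈ 𝓜)
    (hMN : M.cls = N.cls) : coprod K h M hM = coprod K h N hN := by
  obtain ⟨φ, hφ⟩ := (FinMatroid.cls_eq_iff.1 hMN).exists_equiv
  refine Fintype.sum_equiv φ _ _ fun A => ?_
  have h1 : (M.restrict A).cls = (N.restrict (φ A)).cls := FinMatroid.cls_eq_iff.2 (hφ A).1
  have h2 : (M.contract A).cls = (N.contract (φ A)).cls := FinMatroid.cls_eq_iff.2 (hφ A).2
  simp only [h1, h2]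

/-- The restriction-contraction coproduct `δ(M) = ∑_{A ⊆ S} M|A ⊗ M/A` and the counit, equal
to `1` on the empty matroid and to `0` on every other matroid. The coproduct is written with a
chosen representative of each class; it does not depend on the choice, see `comul_vec`. -/
instance : CoalgebraStruct K (MinorCoalgebra K h) where
  comul := lin K h fun c => coprod K h c.1.repr (by rw [MatroidClass.repr_cls]; exact c.2)
  counit := open Classical in lin K h fun c => if c.1 = FinMatroid.empty.cls then 1 else 0

theorem comul_vec (M : FinMatroid.{u}) (hM : M.cls ∈ 𝓜) :
    CoalgebraStruct.comul (R := K) (vec K h ⟨M.cls, hM⟩) =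
      ∑ A : 𝒫 M.E, vec K h ⟨(M.restrict A).cls, h.restrict hM A⟩ ⊗ₜ[K]
        vec K h ⟨(M.contract A).cls, h.contract hM A⟩ :=
  (lin_vec K h _ _).trans (coprod_congr K h _ hM (MatroidClass.repr_cls _))

open Classical in
theorem counit_vec (M : FinMatroid.{u}) (hM : M.cls ∈ 𝓜) :
    CoalgebraStruct.counit (R := K) (vec K h ⟨M.cls, hM⟩) = if M.E = ∅ then 1 else 0 := by
  refine (lin_vec K h _ _).trans ?_
  simp only [FinMatroid.cls_eq_empty_iff]

theorem sigma_powerset_ext {α : Type u} {S : Set α} {f : 𝒫 S → Set α}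
    {x y : Σ A : 𝒫 S, 𝒫 (f A)} (h1 : (x.1 : Set α) = y.1) (h2 : (x.2 : Set α) = y.2) : x = y := by
  obtain ⟨A, B⟩ := x
  obtain ⟨A', B'⟩ := y
  obtain rfl : A = A' := Subtype.ext h1
  obtain rfl : B = B' := Subtype.ext h2
  rfl

theorem restrict_restrict (M : FinMatroid.{u}) {A B : Set M.carrier} (hA : A ∈ 𝒫 M.E)
    (hB : B ⊆ A) :
    (M.restrict ⟨A, hA⟩).restrict ⟨B, hB⟩ = M.restrict ⟨B, hB.trans hA⟩ := by
  simp only [FinMatroid.restrict, Matroid.restrict_restrict_eq M.matroid hB]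

theorem restrict_contract (M : FinMatroid.{u}) {A B : Set M.carrier} (hA : A ∈ 𝒫 M.E)
    (hB : B ⊆ A) :
    (M.restrict ⟨A, hA⟩).contract ⟨B, hB⟩ = (M.contract ⟨B, hB.trans hA⟩).restrict
        ⟨(A \ B : Set M.carrier), Set.sdiff_subset_sdiff_left hA⟩ := by
  simp only [FinMatroid.restrict, FinMatroid.contract,
    Matroid.restrict_contract_eq_contract_restrict M.matroid hB]

theorem contract_contract (M : FinMatroid.{u}) {A B : Set M.carrier} (hA : A ∈ 𝒫 M.E)
    (hB : B ⊆ A) :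
    M.contract ⟨A, hA⟩ = (M.contract ⟨B, hB.trans hA⟩).contract
        ⟨(A \ B : Set M.carrier), Set.sdiff_subset_sdiff_left hA⟩ := by
  have := Matroid.contract_contract M.matroid B (A \ B)
  rw [Set.union_sdiff_cancel hB] at this
  simp only [FinMatroid.contract, this]

theorem comul_coassoc :
    TensorProduct.assoc K (MinorCoalgebra K h) (MinorCoalgebra K h) (MinorCoalgebra K h) ∘ₗ
      (CoalgebraStruct.comul (R := K)).rTensor (MinorCoalgebra K h) ∘ₗ CoalgebraStruct.comul =
    (CoalgebraStruct.comul (R := K)).lTensor (MinorCoalgebra K h) ∘ₗ CoalgebraStruct.comul := by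
  refine lin_ext K h fun M hM => ?_
  simp only [LinearMap.comp_apply, comul_vec, map_sum, LinearMap.rTensor_tmul,
    LinearMap.lTensor_tmul, TensorProduct.sum_tmul, TensorProduct.tmul_sum,
    LinearEquiv.coe_coe, TensorProduct.assoc_tmul]
  rw [← Fintype.sum_sigma', ← Fintype.sum_sigma']
  have hsub : ∀ x : (Σ A : 𝒫 M.E, 𝒫 (M.restrict A).E), (x.2.1 : Set M.carrier) ⊆ x.1.1 :=
    fun x => x.2.2
  refine Fintype.sum_bijective
    (fun x : (Σ A : 𝒫 M.E, 𝒫 (M.restrict A).E) =>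
      (⟨⟨x.2.1, (hsub x).trans x.1.2⟩, ⟨(x.1.1 \ x.2.1 : Set M.carrier),
        Set.sdiff_subset_sdiff_left x.1.2⟩⟩ : Σ A : 𝒫 M.E, 𝒫 (M.contract A).E)) ⟨?_, ?_⟩ _ _ ?_
  · intro x y hxy
    have h1 : (x.2.1 : Set M.carrier) = y.2.1 := congrArg (fun z => (z.1.1 : Set M.carrier)) hxy
    have h2 : (x.1.1 : Set M.carrier) \ x.2.1 = y.1.1 \ y.2.1 :=
      congrArg (fun z => (z.2.1 : Set M.carrier)) hxy
    refine sigma_powerset_ext (f := fun A => (M.restrict A).E) ?_ h1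
    exact (Set.sdiff_union_of_subset (hsub x)).symm.trans
      ((congrArg₂ (· ∪ ·) h2 h1).trans (Set.sdiff_union_of_subset (hsub y)))
  · rintro ⟨⟨B, hB⟩, ⟨C, hC⟩⟩
    change C ⊆ M.E \ B at hC
    refine ⟨⟨⟨C ∪ B, Set.union_subset (hC.trans Set.sdiff_subset) hB⟩,
      ⟨B, Set.subset_union_right⟩⟩, ?_⟩
    refine sigma_powerset_ext (f := fun A => (M.contract A).E) rfl ?_
    exact Set.union_sdiff_cancel_right (fun x hx => (hC hx.1).2 hx.2)
  · rintro ⟨⟨A, hA⟩, ⟨B, hB⟩⟩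
    simp only [restrict_restrict M hA hB, restrict_contract M hA hB, contract_contract M hA hB]

theorem restrict_ground (M : FinMatroid.{u}) : M.restrict ⟨M.E, Set.mem_powerset subset_rfl⟩ = M := by
  cases M
  simp [FinMatroid.restrict]

theorem contract_empty (M : FinMatroid.{u}) : M.contract ⟨∅, Set.mem_powerset (Set.empty_subset _)⟩ = M := by
  cases M
  simp [FinMatroid.contract]

instance : Coalgebra K (MinorCoalgebra K h) where
  coassoc := comul_coassoc K h
  rTensor_counit_comp_comul := by
    classical
    refine lin_ext K h fun M hM => ?_
    simp only [LinearMap.comp_apply, comul_vec, map_sum, LinearMap.rTensor_tmul, counit_vec,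
      TensorProduct.mk_apply]
    rw [Finset.sum_eq_single (⟨∅, Set.mem_powerset (Set.empty_subset _)⟩ : 𝒫 M.E)]
    · rw [if_pos (show (M.restrict ⟨∅, _⟩).E = ∅ from rfl)]
      simp only [contract_empty]
    · rintro ⟨A, hA⟩ - hne
      rw [if_neg, TensorProduct.zero_tmul]
      exact fun hA0 => hne (Subtype.ext hA0)
    · simp
  lTensor_counit_comp_comul := by
    classical
    refine lin_ext K h fun M hM => ?_
    simp only [LinearMap.comp_apply, comul_vec, map_sum, LinearMap.lTensor_tmul, counit_vec,
      TensorProduct.mk_apply, LinearMap.flip_apply]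
    rw [Finset.sum_eq_single (⟨M.E, Set.mem_powerset subset_rfl⟩ : 𝒫 M.E)]
    · rw [if_pos (show (M.contract ⟨M.E, _⟩).E = ∅ from Set.sdiff_self)]
      simp only [restrict_ground]
    · rintro ⟨A, hA⟩ - hne
      rw [if_neg, TensorProduct.tmul_zero]
      exact fun hA0 => hne (Subtype.ext (hA.antisymm (Set.sdiff_eq_empty.1 hA0)))
    · simp

/-- The homogeneous component of rank `r` and nullity `k` of the minor coalgebra. -/
def component (r k : ℕ) : Submodule K (MinorCoalgebra K h) :=
  Submodule.span K {x | ∃ c : 𝓜, c.1.rank = r ∧ c.1.nullity = k ∧ x = vec K h c}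

theorem FinMatroid.rank_add (M : FinMatroid.{u}) (A : 𝒫 M.E) :
    (M.restrict A).cls.rank + (M.contract A).cls.rank = M.cls.rank :=
  rk_restrict_add_rk_contract M.matroid A.2

theorem FinMatroid.nullity_add (M : FinMatroid.{u}) (A : 𝒫 M.E) :
    (M.restrict A).cls.nullity + (M.contract A).cls.nullity = M.cls.nullity := by
  have h1 := M.rank_add A
  have key : ∀ N : FinMatroid.{u}, N.cls.rank + N.cls.nullity = N.E.ncard := fun N =>
    Nat.add_sub_cancel' (rk_le_ncard N.matroid N.matroid.ground_finite)
  have h2 := key M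
  have h3 := key (M.restrict A)
  have h4 := key (M.contract A)
  have h5 : (M.contract A).E.ncard + (M.restrict A).E.ncard = M.E.ncard :=
    Set.ncard_sdiff_add_ncard_of_subset A.2 M.matroid.ground_finite
  omega

theorem exists_vec_ne_zero {f : MinorCoalgebra K h →ₗ[K] K} {p : ℕ × ℕ}
    (hf : ∃ x ∈ component K h p.1 p.2, f x ≠ 0) :
    ∃ (M : FinMatroid.{u}) (hM : M.cls ∈ 𝓜), M.cls.rank = p.1 ∧ M.cls.nullity = p.2 ∧
      f (vec K h ⟨M.cls, hM⟩) ≠ 0 := by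
  by_contra! hcon
  obtain ⟨x, hx, hfx⟩ := hf
  have hle : component K h p.1 p.2 ≤ LinearMap.ker f := by
    refine Submodule.span_le.2 ?_
    rintro _ ⟨⟨c, hc⟩, h1, h2, rfl⟩
    obtain ⟨M, rfl⟩ := Quotient.exists_rep c
    exact hcon M hc h1 h2
  exact hfx (hle hx)

theorem mem_component (M : FinMatroid.{u}) (hM : M.cls ∈ 𝓜) :
    vec K h ⟨M.cls, hM⟩ ∈ component K h M.cls.rank M.cls.nullity :=
  Submodule.subset_span ⟨_, rfl, rfl, rfl⟩

/-- The minor algebra of a minor-closed family: the graded dual of the minor coalgebra, that is,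
the algebra of all linear functionals on the minor coalgebra that vanish on all but finitely
many of the homogeneous components, under the convolution product
`f * g = (f ⊗ g) ∘ δ`, whose unit is the counit. -/
def minorAlgebra : Subalgebra K (WithConv (MinorCoalgebra K h →ₗ[K] K)) where
  carrier := {f | {p : ℕ × ℕ | ∃ x ∈ component K h p.1 p.2, f x ≠ 0}.Finite}
  mul_mem' := by
    intro f g hf hg
    refine (hf.add hg).subset fun p hp => ?_
    obtain ⟨M, hM, h1, h2, h3⟩ := exists_vec_ne_zero K h (f := (f * g).ofConv) hp
    change LinearMap.mul' K K (TensorProduct.map f.ofConv g.ofConv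
      (CoalgebraStruct.comul (vec K h ⟨M.cls, hM⟩))) ≠ 0 at h3
    rw [comul_vec, map_sum, map_sum] at h3
    obtain ⟨A, -, hA⟩ := Finset.exists_ne_zero_of_sum_ne_zero h3
    rw [TensorProduct.map_tmul, LinearMap.mul'_apply] at hA
    refine Set.mem_add.2 ⟨((M.restrict A).cls.rank, (M.restrict A).cls.nullity),
      ⟨_, mem_component K h _ (h.restrict hM A), left_ne_zero_of_mul hA⟩,
      ((M.contract A).cls.rank, (M.contract A).cls.nullity),
      ⟨_, mem_component K h _ (h.contract hM A), right_ne_zero_of_mul hA⟩, ?_⟩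
    exact Prod.ext ((M.rank_add A).trans h1) ((M.nullity_add A).trans h2)
  add_mem' := by
    intro f g hf hg
    refine (hf.union hg).subset ?_
    rintro p ⟨x, hx, hne⟩
    by_contra hcon
    simp only [Set.mem_union, Set.mem_ofPred_eq, not_or, not_exists, not_and, not_not] at hcon
    refine hne ?_
    change f x + g x = 0
    rw [hcon.1 x hx, hcon.2 x hx, add_zero]
  algebraMap_mem' := by
    intro a
    refine (Set.finite_singleton ((FinMatroid.empty.{u}).cls.rank,
      (FinMatroid.empty.{u}).cls.nullity)).subset fun p hp => ?_
    obtain ⟨M, hM, h1, h2, h3⟩ := exists_vec_ne_zero K h 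
      (f := (algebraMap K (WithConv (MinorCoalgebra K h →ₗ[K] K)) a).ofConv) hp
    have hE : M.cls = FinMatroid.empty.cls := by
      rw [FinMatroid.cls_eq_empty_iff]
      by_contra hE
      refine h3 ?_
      classical
      change a • (CoalgebraStruct.counit (R := K) (vec K h ⟨M.cls, hM⟩)) = 0
      rw [counit_vec, if_neg hE, smul_zero]
    rw [← hE]
    exact Prod.ext h1.symm h2.symm

/-- The element of the minor algebra corresponding to (the isomorphism class of) a matroid in
the family: the functional with value `1` on this class and `0` on all other classes. -/
def dualVec (c : 𝓜) : minorAlgebra K h :=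
  open Classical in
  ⟨WithConv.toConv (lin K h fun c' => if c = c' then 1 else 0), by
    refine (Set.finite_singleton (c.1.rank, c.1.nullity)).subset fun p hp => ?_
    obtain ⟨M, hM, h1, h2, h3⟩ := exists_vec_ne_zero K h hp
    have hc : c = ⟨M.cls, hM⟩ := by
      by_contra hc
      refine h3 ?_
      change lin K h _ _ = 0
      rw [lin_vec, if_neg hc]
    rw [hc]
    exact Prod.ext h1.symm h2.symm⟩

end Coalgebra

end MatroidMinor

end

/-!
The theorem combines unique factorization of matroids under the free product with a triangularity
argument for the weak order.

*Unique factorization.* A factorization of `M` as a free product, up to isomorphism, is the same as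
a free separator of `M` (`iso_freeProduct_iff`): a set `A` such that every circuit `C` satisfies
`C ⊆ A` or `A ⊆ cl C` (`freeSep_iff_isCircuit`). If two free separators are incomparable, the
closure of a circuit is either contained in their intersection or contains their union. Hence the
elements of their symmetric difference are interchangeable, and an automorphism of `M` moves the
smaller separator inside the larger one (`FreeSep.exists_subset`). Nested free separators restrict
and contract to free separators, so the isomorphism classes form a monoid in which any two
factorizations of an element have a common refinement (`MatroidClass.exists_refinement`). Such a
monoid, graded by size, is free on its irreducible elements
(`injective_lift_of_refinement`, `exists_wordClass_eq`).

*Triangularity.* If `L|A ≅ M` and `L/A ≅ N`, then `L` lies below `M □ N` in the weak order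
(`weakLE_freeProduct`). Therefore the product, in the minor algebra, of a word of irreducible
classes is supported on matroids below the free product of the word
(`weakLE_of_coeff_wordProd_ne_zero`). The free product itself occurs with a positive integer
coefficient, which is nonzero in characteristic zero (`coeff_wordProd_wordClass_ne_zero`). A matroid
strictly below another has fewer independent sets, so the number of independent sets is a level
with respect to which the products of words are triangular over the dual basis. There are finitely
many classes of each size, so the dual basis is a basis of the graded dual (`coeffEquiv`).
Consequently the products of words form a basis (`bijective_linearCombination_of_triangular`), and
the canonical map carries the basis of words of the free algebra to it.
-/

namespace MatroidMinor

/-! ### Monoids with refinement of factorizations -/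

section FreeMonoid

/-- In a monoid with an additive size function that vanishes only at `1`, suppose that two
factorizations of an element always have a common refinement, the cut with the smaller left
factor coming first. Then products of irreducible elements are unique. -/
theorem injective_lift_of_refinement {W X : Type*} [Monoid W] (size : W → ℕ)
    (size_mul : ∀ a b, size (a * b) = size a + size b)
    (eq_one : ∀ a, size a = 0 → a = 1)
    (hrefine : ∀ p q r s : W, p * q = r * s → size r ≤ size p →
      ∃ t, p = r * t ∧ s = t * q)
    (f : X → W) (hf : Function.Injective f)
    (hf1 : ∀ x, f x ≠ 1) (hirr : ∀ x p q, f x = p * q → f x = p ∨ f x = q) :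
    Function.Injective (FreeMonoid.lift f) := by
  have hpos : ∀ x, 0 < size (f x) := fun x => Nat.pos_of_ne_zero fun h => hf1 x (eq_one _ h)
  -- The first letters of two words with the same product agree, and so do the remaining products.
  have cancel : ∀ (x y : X) (p q : W), f x * p = f y * q → size (f y) ≤ size (f x) →
      x = y ∧ p = q := by
    intro x y p q h hle
    obtain ⟨t, h1, h2⟩ := hrefine _ _ _ _ h hle
    have h3 : size (f x) = size (f y) + size t := h1 ▸ size_mul _ _
    have hy := hpos y
    rcases hirr x _ _ h1 with h4 | h4
    · have h5 : size t = 0 := by rw [h4] at h3; omega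
      rw [eq_one t h5, one_mul] at h2
      exact ⟨hf h4, h2.symm⟩
    · rw [← h4] at h3; omega
  intro a
  induction a using FreeMonoid.recOn with
  | one =>
    intro b
    induction b using FreeMonoid.casesOn with
    | one => exact fun _ => rfl
    | of_mul y b =>
      intro h
      rw [map_one, map_mul, FreeMonoid.lift_eval_of] at h
      have h1 := size_mul (f y) (FreeMonoid.lift f b)
      have h2 := size_mul (1 : W) 1
      rw [← h] at h1
      rw [one_mul] at h2
      have := hpos y
      omega
  | of_mul x a ih =>
    intro b
    induction b using FreeMonoid.casesOn with
    | one =>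
      intro h
      rw [map_one, map_mul, FreeMonoid.lift_eval_of] at h
      have h1 := size_mul (f x) (FreeMonoid.lift f a)
      have h2 := size_mul (1 : W) 1
      rw [h] at h1
      rw [one_mul] at h2
      have := hpos x
      omega
    | of_mul y b =>
      intro h
      simp only [map_mul, FreeMonoid.lift_eval_of] at h
      rcases le_total (size (f y)) (size (f x)) with hle | hle
      · obtain ⟨rfl, h'⟩ := cancel x y _ _ h hle
        rw [ih h']
      · obtain ⟨rfl, h'⟩ := cancel y x _ _ h.symm hle
        rw [ih h'.symm]

end FreeMonoid

/-! ### Triangular families -/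

section Triangular

/-- A family of finitely supported functions that is triangular with nonzero diagonal, with
respect to a level function to `ℕ`, is a basis. No finiteness is needed: distinct indices of the
same level do not interact. -/
theorem bijective_linearCombination_of_triangular {K ι : Type*} [Field K] (μ : ι → ℕ)
    (x : ι → ι →₀ K) (hdiag : ∀ i, x i i ≠ 0)
    (hlt : ∀ i j, x i j ≠ 0 → j = i ∨ μ j < μ i) :
    Function.Bijective (Finsupp.linearCombination K x) := by
  constructor
  · rw [injective_iff_map_eq_zero]
    intro c hc
    by_contra hne
    obtain ⟨i, hi, hmax⟩ := c.support.exists_max_image μ (Finsupp.support_nonempty_iff.2 hne)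
    -- At an index of maximal level in the support, only the diagonal entry contributes.
    have h := DFunLike.congr_fun hc i
    rw [Finsupp.linearCombination_apply, Finsupp.sum, Finsupp.finsetSum_apply,
      Finset.sum_eq_single i] at h
    · simp only [Finsupp.smul_apply, smul_eq_mul, Finsupp.zero_apply, mul_eq_zero] at h
      exact h.elim (Finsupp.mem_support_iff.1 hi) (hdiag i)
    · intro j hj hji
      by_contra h0
      rcases hlt j i (fun h => h0 (by simp [h])) with h1 | h1
      · exact hji h1.symm
      · exact absurd (hmax j hj) (not_le.2 h1)
    · exact fun h => absurd hi h
  · classical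
    rw [← LinearMap.range_eq_top, eq_top_iff]
    have key : ∀ n i, μ i = n →
        Finsupp.single i (1 : K) ∈ LinearMap.range (Finsupp.linearCombination K x) := by
      intro n
      induction n using Nat.strong_induction_on with
      | _ n ih =>
        intro i hi
        have hx : x i ∈ LinearMap.range (Finsupp.linearCombination K x) :=
          ⟨Finsupp.single i 1, by simp⟩
        have hsum : x i = x i i • Finsupp.single i 1 + ∑ j ∈ (x i).support.erase i,
            x i j • Finsupp.single j (1 : K) := by
          by_cases h : i ∈ (x i).support
          · rw [Finset.add_sum_erase _ (fun j => x i j • Finsupp.single j (1 : K)) h]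
            conv_lhs => rw [← Finsupp.sum_single (x i)]
            simp [Finsupp.sum]
          · exact absurd (Finsupp.mem_support_iff.2 (hdiag i)) h
        have hrest : ∑ j ∈ (x i).support.erase i, x i j • Finsupp.single j (1 : K) ∈
            LinearMap.range (Finsupp.linearCombination K x) := by
          refine Submodule.sum_mem _ fun j hj => Submodule.smul_mem _ _ ?_
          rw [Finset.mem_erase, Finsupp.mem_support_iff] at hj
          exact ih _ (hi ▸ (hlt i j hj.2).resolve_left hj.1) j rfl
        have h2 : x i i • Finsupp.single i (1 : K) ∈
            LinearMap.range (Finsupp.linearCombination K x) := by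
          rw [eq_sub_of_add_eq hsum.symm]
          exact Submodule.sub_mem _ hx hrest
        exact (Submodule.smul_mem_iff _ (hdiag i)).1 h2
    intro f _
    rw [← Finsupp.sum_single f]
    refine Submodule.sum_mem _ fun i _ => ?_
    have := Submodule.smul_mem _ (f i) (key _ i rfl)
    simpa using this

end Triangular

/-! ### Isomorphisms, ranks and free products under injective maps -/

section Maps

variable {α : Type u} {β : Type v} {γ : Type w}

/-- Two matroids are isomorphic exactly when both are injective images of a third one. This form
of isomorphism needs no case distinction for empty ground sets, and is convenient for
transporting subsets. -/
theorem Iso.exists_common {M : Matroid α} {N : Matroid β} (h : Iso M N) :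
    ∃ (γ : Type u) (L : Matroid γ) (g : γ → α) (k : γ → β) (hg : g.Injective)
      (hk : k.Injective), M = L.map g hg.injOn ∧ N = L.map k hk.injOn := by
  obtain ⟨e, he⟩ := h
  have hk : Function.Injective (fun x : M.E => (e x : β)) :=
    Subtype.val_injective.comp e.injective
  have hM : M = (M.restrictSubtype M.E).map Subtype.val Subtype.val_injective.injOn := by
    simp
  refine ⟨M.E, M.restrictSubtype M.E, Subtype.val, fun x => e x, Subtype.val_injective, hk,
    hM, ?_⟩
  refine Matroid.ext_indep ?_ fun I hI => ?_
  · ext x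
    simp only [Matroid.map_ground, Matroid.restrictSubtype_ground, Set.image_univ, Set.mem_range]
    exact ⟨fun hx => ⟨e.symm ⟨x, hx⟩, by simp⟩, by rintro ⟨y, rfl⟩; exact (e y).2⟩
  · obtain ⟨J, rfl⟩ : ∃ J : Set M.E, I = (fun x : M.E => (e x : β)) '' J := by
      refine ⟨e ⁻¹' (Subtype.val ⁻¹' I), ?_⟩
      rw [← Set.image_image Subtype.val e, Equiv.image_preimage, Subtype.image_preimage_coe,
        Set.inter_eq_self_of_subset_right hI]
    rw [Matroid.map_image_indep_iff (by simp), Matroid.restrictSubtype_indep_iff, he,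
      Set.image_image]

theorem iso_map_map (L : Matroid γ) {g : γ → α} {k : γ → β} (hg : Set.InjOn g L.E)
    (hk : Set.InjOn k L.E) : Iso (L.map g hg) (L.map k hk) :=
  (iso_map L g hg).symm.trans (iso_map L k hk)

theorem rk_map (L : Matroid γ) {g : γ → α} (hg : Set.InjOn g L.E) {X : Set γ} (hX : X ⊆ L.E) :
    rk (L.map g hg) (g '' X) = rk L X := by
  rw [rk, rk, Matroid.eRk_map _ hg hX]

theorem rk_restrict (M : Matroid α) {A X : Set α} (h : X ⊆ A) : rk (M ↾ A) X = rk M X := by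
  rw [rk, rk, Matroid.restrict_eRk_eq _ h]

theorem restrict_finite (M : Matroid α) [M.Finite] {A : Set α} (hA : A ⊆ M.E) : (M ↾ A).Finite :=
  Matroid.restrict_finite (M.ground_finite.subset hA)

theorem rk_add_rk_contract (M : Matroid α) [M.Finite] {A X : Set α} (hA : A ⊆ M.E)
    (hX : X ⊆ M.E) : rk M A + rk (M ／ A) (X \ A) = rk M (X ∪ A) := by
  have := restrict_finite M (Set.union_subset hX hA)
  have h := rk_restrict_add_rk_contract (M ↾ (X ∪ A)) (A := A) Set.subset_union_right
  rwa [Matroid.restrict_restrict_eq M Set.subset_union_right, rk_restrict M subset_rfl,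
    Matroid.restrict_contract_eq_contract_restrict M Set.subset_union_right,
    Matroid.restrict_ground_eq, rk_restrict _ subset_rfl, rk_restrict _ subset_rfl,
    Set.union_sdiff_right] at h

theorem indep_of_ncard_le_rk (M : Matroid α) [M.Finite] {I : Set α} (hI : I ⊆ M.E)
    (h : I.ncard ≤ rk M I) : M.Indep I := by
  have hf := M.ground_finite.subset hI
  refine (M.isRkFinite_set I).indep_of_encard_le_eRk ?_
  rw [← coe_rk, ← hf.cast_ncard_eq]
  exact_mod_cast h

theorem freeProduct_map {α' : Type*} {β' : Type*} (M : Matroid α) (N : Matroid β) [M.Finite]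
    [N.Finite] {f : α → α'} {g : β → β'} (hf : f.Injective) (hg : g.Injective) :
    freeProduct (M.map f hf.injOn) (N.map g hg.injOn) =
      (freeProduct M N).map (Sum.map f g) (hf.sumMap hg).injOn := by
  have himg : ∀ X : Set (α ⊕ β), Sum.inl ⁻¹' (Sum.map f g '' X) = f '' (Sum.inl ⁻¹' X) ∧
      Sum.inr ⁻¹' (Sum.map f g '' X) = g '' (Sum.inr ⁻¹' X) := by
    intro X
    constructor <;> ext y <;> simp
  have hE : Sum.inl '' (f '' M.E) ∪ Sum.inr '' (g '' N.E) =
      Sum.map f g '' (Sum.inl '' M.E ∪ Sum.inr '' N.E) := by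
    simp [Set.image_union, Set.image_image]
  refine Matroid.ext_indep (by simpa using hE) fun I hI => ?_
  obtain ⟨J, hJ, rfl⟩ := Set.subset_image_iff.1 (hI.trans hE.subset)
  rw [Matroid.map_image_indep_iff hJ, freeProduct_indep, freeProduct_indep, freeIndep_iff,
    freeIndep_iff, (himg J).1, (himg J).2]
  have hl : Sum.inl ⁻¹' J ⊆ M.E := fun x hx => by simpa using hJ hx
  have hr : Sum.inr ⁻¹' J ⊆ N.E := fun x hx => by simpa using hJ hx
  rw [Matroid.map_image_indep_iff hl, Matroid.map_ground, Matroid.map_ground,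
    rk_map _ _ subset_rfl, rk_map _ _ hr, Set.ncard_image_of_injective _ (hf.sumMap hg)]
  exact and_congr_left fun _ => ⟨fun _ => hJ, fun _ => hI⟩

theorem Iso.freeProduct {α' : Type*} {β' : Type*} {M : Matroid α} {M' : Matroid α'}
    {N : Matroid β} {N' : Matroid β'} [M.Finite] [M'.Finite] [N.Finite] [N'.Finite]
    (h : Iso M M') (h' : Iso N N') : Iso (freeProduct M N) (freeProduct M' N') := by
  obtain ⟨γ, L, g, k, hg, hk, h1, h2⟩ := h.exists_common
  obtain ⟨γ', L', g', k', hg', hk', h1', h2'⟩ := h'.exists_common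
  have hL : L.Finite := ⟨Set.Finite.of_finite_image
    (h1 ▸ M.ground_finite : (L.map g hg.injOn).E.Finite) hg.injOn⟩
  have hL' : L'.Finite := ⟨Set.Finite.of_finite_image
    (h1' ▸ N.ground_finite : (L'.map g' hg'.injOn).E.Finite) hg'.injOn⟩
  subst h1 h2 h1' h2'
  rw [freeProduct_map _ _ hg hg', freeProduct_map _ _ hk hk']
  exact iso_map_map _ _ _

end Maps

/-! ### Free separators -/

section FreeSep

variable {α : Type u} {β : Type v} {γ : Type w}

/-- A subset `A` of the ground set of `M` is a free separator if `M` is the free product of `M|A`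
and `M/A`: the sets which are independent in that free product are independent in `M`. The
converse always holds. The inequality is the one defining the free product, because
`ρ(I ∪ A) = ρ(A) + ρ_{M/A}(I \ A)`. -/
def FreeSep (M : Matroid α) (A : Set α) : Prop :=
  A ⊆ M.E ∧ ∀ I ⊆ M.E, M.Indep (I ∩ A) → I.ncard ≤ rk M (I ∪ A) → M.Indep I

theorem ncard_le_rk_union {M : Matroid α} [M.Finite] {I : Set α} (hI : M.Indep I) (A : Set α) :
    I.ncard ≤ rk M (I ∪ A) := by
  rw [← rk_eq_ncard hI]
  exact rk_mono M Set.subset_union_left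

/-- Free separators in terms of circuits; equivalently, every cyclic flat is comparable to `A`. -/
theorem freeSep_iff_isCircuit {M : Matroid α} [M.Finite] {A : Set α} (hA : A ⊆ M.E) :
    FreeSep M A ↔ ∀ C, M.IsCircuit C → C ⊆ A ∨ A ⊆ M.closure C := by
  constructor
  · intro h C hC
    by_contra! hcon
    obtain ⟨hCA, hAC⟩ := hcon
    obtain ⟨a, haA, haC⟩ := Set.not_subset.1 hAC
    refine hC.dep.not_indep (h.2 C hC.subset_ground ?_ ?_)
    -- If `A` is not in the closure of `C`, then `ρ(C ∪ A) ≥ ρ(C) + 1 = |C|`.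
    · refine hC.ssubset_indep (Set.inter_subset_left.ssubset_of_ne fun h => hCA ?_)
      exact Set.inter_eq_left.1 h
    · have hCf := M.ground_finite.subset hC.subset_ground
      have h1 := hC.eRk_add_one_eq
      have h2 := M.eRk_insert_eq_add_one ⟨hA haA, haC⟩
      rw [← coe_rk, ← hCf.cast_ncard_eq] at h1
      rw [← coe_rk, ← coe_rk] at h2
      have h3 : rk M C + 1 = C.ncard := by exact_mod_cast h1
      have h4 : rk M (insert a C) = rk M C + 1 := by exact_mod_cast h2
      rw [← h3, ← h4]
      exact rk_mono M (Set.insert_subset (Or.inr haA) Set.subset_union_left)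
  · intro h
    refine ⟨hA, fun I hI hIA hle => ?_⟩
    by_contra hdep
    obtain ⟨C, hCI, hC⟩ := ((M.not_indep_iff hI).1 hdep).exists_isCircuit_subset
    rcases h C hC with h1 | h1
    · exact hC.dep.not_indep (hIA.subset (Set.subset_inter hCI h1))
    · have h2 : M.eRk (I ∪ A) ≤ M.eRk I := by
        rw [← M.eRk_closure_eq I]
        exact M.eRk_mono (Set.union_subset (M.subset_closure I hI)
          (h1.trans (M.closure_subset_closure hCI)))
      rw [← coe_rk, ← coe_rk] at h2
      exact hdep (indep_of_ncard_le_rk M hI (hle.trans (by exact_mod_cast h2)))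

theorem freeSep_map_iff {L : Matroid γ} {g : γ → α} (hg : g.Injective) {A : Set γ} :
    FreeSep (L.map g hg.injOn) (g '' A) ↔ FreeSep L A := by
  have hsub : ∀ X : Set γ, g '' X ⊆ g '' L.E ↔ X ⊆ L.E := fun X =>
    Set.image_subset_image_iff hg
  constructor
  · rintro ⟨h1, h2⟩
    rw [Matroid.map_ground, hsub] at h1
    refine ⟨h1, fun I hI hIA hle => ?_⟩
    rw [← Matroid.map_image_indep_iff (f := g) (hf := hg.injOn) hI]
    refine h2 _ ((hsub I).2 hI) ?_ ?_
    · rwa [← Set.image_inter hg, Matroid.map_image_indep_iff (Set.inter_subset_left.trans hI)]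
    · rwa [← Set.image_union, rk_map _ _ (Set.union_subset hI h1),
        Set.ncard_image_of_injective _ hg]
  · rintro ⟨h1, h2⟩
    refine ⟨(hsub A).2 h1, fun J hJ hIA hle => ?_⟩
    obtain ⟨I, hI, rfl⟩ := Set.subset_image_iff.1 (show J ⊆ g '' L.E from hJ)
    rw [← Set.image_inter hg, Matroid.map_image_indep_iff (Set.inter_subset_left.trans hI)] at hIA
    rw [← Set.image_union, rk_map _ _ (Set.union_subset hI h1),
        Set.ncard_image_of_injective _ hg] at hle
    rw [Matroid.map_image_indep_iff hI]
    exact h2 I hI hIA hle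

theorem freeProduct_restrict_inl (P : Matroid α) (Q : Matroid β) [P.Finite] [Q.Finite] :
    freeProduct P Q ↾ (Sum.inl '' P.E) = P.map Sum.inl Sum.inl_injective.injOn := by
  refine Matroid.ext_indep rfl fun I (hI : I ⊆ Sum.inl '' P.E) => ?_
  obtain ⟨J, hJ, rfl⟩ := Set.subset_image_iff.1 hI
  rw [Matroid.map_image_indep_iff hJ, Matroid.restrict_indep_iff, freeProduct_indep, FreeIndep]
  have h1 : Sum.inr ⁻¹' (Sum.inl '' J : Set (α ⊕ β)) = ∅ := by ext; simp
  rw [Set.preimage_image_eq _ Sum.inl_injective, h1]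
  have h2 : nul Q ∅ = 0 := by simp [nul]
  rw [h2]
  exact ⟨fun h => h.1.2.1,
    fun h => ⟨⟨hI.trans Set.subset_union_left, h, Nat.zero_le _⟩, hI⟩⟩

/-- For a base `B` of `P`, which is a basis of the ground set of `P` in `P □ Q`, the rank-lack of `B`
is zero, so `B ∪ J` is independent in `P □ Q` exactly when `J` has nullity zero in `Q`. -/
theorem freeProduct_contract_inl (P : Matroid α) (Q : Matroid β) [P.Finite] [Q.Finite] :
    freeProduct P Q ／ (Sum.inl '' P.E) = Q.map Sum.inr Sum.inr_injective.injOn := by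
  obtain ⟨B, hB⟩ := P.exists_isBase
  have hbasis : (freeProduct P Q).IsBasis (Sum.inl '' B) (Sum.inl '' P.E) := by
    rw [← Matroid.isBase_restrict_iff (by simp), freeProduct_restrict_inl]
    exact hB.map _
  have hE : (Sum.inl '' P.E ∪ Sum.inr '' Q.E : Set (α ⊕ β)) \ Sum.inl '' P.E = Sum.inr '' Q.E := by
    ext (x | x) <;> simp
  refine Matroid.ext_indep hE fun I hI => ?_
  rw [Matroid.contract_ground, freeProduct_ground, hE] at hI
  obtain ⟨J, hJ, rfl⟩ := Set.subset_image_iff.1 hI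
  have hl : Sum.inl ⁻¹' (Sum.inr '' J ∪ Sum.inl '' B : Set (α ⊕ β)) = B := by ext; simp
  have hr : Sum.inr ⁻¹' (Sum.inr '' J ∪ Sum.inl '' B : Set (α ⊕ β)) = J := by ext; simp
  have hfin : (Sum.inr '' J ∪ Sum.inl '' B : Set (α ⊕ β)).Finite :=
    ((Q.ground_finite.subset hJ).image _).union (hB.finite.image _)
  have hBrk : rk P P.E = B.ncard := by
    rw [rk, P.eRk_ground, ← hB.encard_eq_eRank, Set.ncard]
  rw [Matroid.map_image_indep_iff hJ, hbasis.contract_indep_iff, freeProduct_indep, freeIndep_iff,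
    hl, hr, ncard_sum hfin, hl, hr, hBrk]
  constructor
  · rintro ⟨⟨-, -, h⟩, -⟩
    exact indep_of_ncard_le_rk Q hJ (by omega)
  · intro h
    refine ⟨⟨?_, hB.indep, by rw [rk_eq_ncard h]⟩, ?_⟩
    · exact Set.union_subset (hI.trans Set.subset_union_right)
        ((Set.image_mono hB.subset_ground).trans Set.subset_union_left)
    · rw [Set.disjoint_left]
      rintro _ ⟨x, -, rfl⟩ ⟨y, -, h⟩
      exact absurd h (by simp)

theorem freeSep_inl (P : Matroid α) (Q : Matroid β) [P.Finite] [Q.Finite] :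
    FreeSep (freeProduct P Q) (Sum.inl '' P.E) := by
  refine ⟨Set.subset_union_left, fun I hI hIA hle => ?_⟩
  rw [freeProduct_indep, freeIndep_iff]
  have hfin := (ground_sum_finite P Q).subset hI
  have hl : Sum.inl ⁻¹' I ⊆ P.E := fun x hx => by simpa using hI hx
  have hr : Sum.inr ⁻¹' I ⊆ Q.E := fun x hx => by simpa using hI hx
  have h1 : Sum.inl ⁻¹' (I ∩ Sum.inl '' P.E) = Sum.inl ⁻¹' I := by
    rw [Set.preimage_inter, Set.preimage_image_eq _ Sum.inl_injective,
      Set.inter_eq_self_of_subset_left hl]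
  have h2 : I \ Sum.inl '' P.E = Sum.inr '' (Sum.inr ⁻¹' I) := by
    ext (x | x)
    · simpa using fun h => hl h
    · simp
  refine ⟨hI, ?_, ?_⟩
  · rw [freeProduct_indep, FreeIndep, h1] at hIA
    exact hIA.2.1
  · have h3 := rk_add_rk_contract (freeProduct P Q) (A := Sum.inl '' P.E) Set.subset_union_left hI
    rw [freeProduct_contract_inl, h2, rk_map _ _ hr, ← rk_restrict _ subset_rfl,
      freeProduct_restrict_inl, rk_map _ _ subset_rfl] at h3
    rwa [h3]

/-- A subset `I` of the ground set of `M`, seen in the disjoint union of `A` and its complement, is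
independent in `M|A □ M/A` exactly when `I ∩ A` is independent and `|I| ≤ ρ(I ∪ A)`. -/
theorem freeProduct_restrict_contract_indep_iff (M : Matroid α) [M.Finite] {A : Set α}
    (hA : A ⊆ M.E) [(M ↾ A).Finite] {I : Set α} (hI : I ⊆ M.E) :
    (freeProduct (M ↾ A) (M ／ A)).Indep (Sum.inl '' (I ∩ A) ∪ Sum.inr '' (I \ A)) ↔
      M.Indep (I ∩ A) ∧ I.ncard ≤ rk M (I ∪ A) := by
  have hl : Sum.inl ⁻¹' (Sum.inl '' (I ∩ A) ∪ Sum.inr '' (I \ A) : Set (α ⊕ α)) = I ∩ A := by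
    ext; simp
  have hr : Sum.inr ⁻¹' (Sum.inl '' (I ∩ A) ∪ Sum.inr '' (I \ A) : Set (α ⊕ α)) = I \ A := by
    ext; simp
  have hfin := M.ground_finite.subset hI
  have hcard := Set.ncard_inter_add_ncard_sdiff_eq_ncard I A hfin
  rw [freeProduct_indep, freeIndep_iff, hl, hr, ncard_sum (((hfin.inter_of_left A).image _).union
    (hfin.sdiff.image _)), hl, hr, hcard, Matroid.restrict_ground_eq, rk_restrict _ subset_rfl,
    rk_add_rk_contract M hA hI, Matroid.restrict_indep_iff]
  refine ⟨fun h => ⟨h.2.1.1, h.2.2⟩, fun h => ⟨?_, ⟨h.1, Set.inter_subset_right⟩, h.2⟩⟩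
  exact Set.union_subset_union (Set.image_mono Set.inter_subset_right)
    (Set.image_mono (Set.sdiff_subset_sdiff_left hI))

theorem injOn_elim_id (M : Matroid α) [M.Finite] (A : Set α) [(M ↾ A).Finite] :
    Set.InjOn (Sum.elim id id) (freeProduct (M ↾ A) (M ／ A)).E := by
  rintro (x | x) hx (y | y) hy h <;> simp_all

theorem elim_id_image (I A : Set α) :
    Sum.elim id id '' (Sum.inl '' (I ∩ A) ∪ Sum.inr '' (I \ A) : Set (α ⊕ α)) = I := by
  simp [Set.image_union, Set.image_image, Set.inter_union_sdiff]

/-- For a free separator `A`, folding the two summands of the ground set of `M|A □ M/A` gives back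
`M`. -/
theorem FreeSep.map_freeProduct_eq {M : Matroid α} [M.Finite] {A : Set α} (h : FreeSep M A)
    [(M ↾ A).Finite] :
    (freeProduct (M ↾ A) (M ／ A)).map (Sum.elim id id) (injOn_elim_id M A) = M := by
  have hE : Sum.elim id id '' (Sum.inl '' A ∪ Sum.inr '' (M.E \ A)) = M.E := by
    have := elim_id_image M.E A
    rwa [Set.inter_eq_self_of_subset_right h.1] at this
  refine Matroid.ext_indep hE fun I hI => ?_
  have hIE : I ⊆ M.E := hI.trans hE.subset
  have hsub : (Sum.inl '' (I ∩ A) ∪ Sum.inr '' (I \ A) : Set (α ⊕ α)) ⊆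
      (freeProduct (M ↾ A) (M ／ A)).E :=
    Set.union_subset_union (Set.image_mono Set.inter_subset_right)
      (Set.image_mono (Set.sdiff_subset_sdiff_left hIE))
  conv_lhs => rw [← elim_id_image I A]
  rw [Matroid.map_image_indep_iff hsub, freeProduct_restrict_contract_indep_iff M h.1 hIE]
  exact ⟨fun h' => h.2 I hIE h'.1 h'.2,
    fun h' => ⟨h'.subset Set.inter_subset_left, ncard_le_rk_union h' A⟩⟩

/-- Factorizations as a free product, up to isomorphism, are free separators. -/
theorem iso_freeProduct_iff {M : Matroid α} {P : Matroid β} {Q : Matroid γ} [M.Finite] [P.Finite]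
    [Q.Finite] : Iso M (freeProduct P Q) ↔
      ∃ A, FreeSep M A ∧ Iso (M ↾ A) P ∧ Iso (M ／ A) Q := by
  constructor
  · intro h
    obtain ⟨δ, L, g, k, hg, hk, h1, h2⟩ := h.exists_common
    have hsep := freeSep_inl P Q
    have hres := freeProduct_restrict_inl P Q
    have hcon := freeProduct_contract_inl P Q
    have hsub : (Sum.inl '' P.E : Set (β ⊕ γ)) ⊆ k '' L.E :=
      hsep.1.trans (congrArg Matroid.E h2).subset
    obtain ⟨A, hA, hAP⟩ := Set.subset_image_iff.1 hsub
    rw [← hAP, h2] at hsep hres hcon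
    rw [freeSep_map_iff hk] at hsep
    rw [map_restrict _ _ _ hA] at hres
    rw [map_contract _ _ _ hA] at hcon
    refine ⟨g '' A, h1 ▸ (freeSep_map_iff hg).2 hsep, ?_, ?_⟩
    · have h3 := iso_map_map (L ↾ A) hg.injOn hk.injOn
      rw [hres] at h3
      rw [h1, map_restrict _ _ _ hA]
      exact h3.trans (iso_map _ _ _).symm
    · have h3 := iso_map_map (L ／ A) hg.injOn hk.injOn
      rw [hcon] at h3
      rw [h1, map_contract _ _ _ hA]
      exact h3.trans (iso_map _ _ _).symm
  · rintro ⟨A, hA, h1, h2⟩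
    have := restrict_finite M hA.1
    refine Iso.trans ?_ (h1.freeProduct h2)
    have h3 := iso_map (freeProduct (M ↾ A) (M ／ A)) (Sum.elim id id) (injOn_elim_id M A)
    rw [hA.map_freeProduct_eq] at h3
    exact h3.symm

end FreeSep

/-! ### Nested and incomparable free separators -/

section Refinement

variable {α : Type u} {β : Type v} {γ : Type w} {M : Matroid α} {A B : Set α}

theorem FreeSep.of_restrict [M.Finite] (hB : FreeSep M B) (hA : FreeSep (M ↾ B) A) :
    FreeSep M A := by
  have := restrict_finite M hB.1
  have hAB : A ⊆ B := hA.1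
  rw [freeSep_iff_isCircuit hA.1] at hA
  rw [freeSep_iff_isCircuit (hAB.trans hB.1)]
  intro C hC
  rcases (freeSep_iff_isCircuit hB.1).1 hB C hC with h | h
  · refine (hA C ((Matroid.restrict_isCircuit_iff hB.1).2 ⟨hC, h⟩)).imp_right fun h' => ?_
    rw [Matroid.restrict_closure_eq M h hB.1] at h'
    exact h'.trans Set.inter_subset_left
  · exact Or.inr (hAB.trans h)

theorem FreeSep.restrict (hA : FreeSep M A) (hAB : A ⊆ B) (hB : B ⊆ M.E) :
    FreeSep (M ↾ B) A := by
  refine ⟨hAB, fun I (hI : I ⊆ B) hIA hle => ?_⟩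
  rw [rk_restrict M (Set.union_subset hI hAB)] at hle
  exact M.restrict_indep_iff.2
    ⟨hA.2 I (hI.trans hB) ((M.restrict_indep_iff).1 hIA).1 hle, hI⟩

theorem FreeSep.contract [M.Finite] (hB : FreeSep M B) (A : Set α) :
    FreeSep (M ／ A) (B \ A) := by
  rw [freeSep_iff_isCircuit (show B \ A ⊆ M.E \ A from Set.sdiff_subset_sdiff_left hB.1)]
  intro C hC
  obtain ⟨C', hC', h1, h2⟩ := hC.exists_subset_isCircuit_of_contract
  have hCA : Disjoint C A := (Set.subset_sdiff.1 hC.subset_ground).2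
  rcases (freeSep_iff_isCircuit hB.1).1 hB C' hC' with h | h
  · exact Or.inl (Set.subset_sdiff.2 ⟨h1.trans h, hCA⟩)
  · refine Or.inr ?_
    rw [Matroid.contract_closure_eq]
    exact Set.sdiff_subset_sdiff_left (h.trans (M.closure_subset_closure h2))

/-- The closure of a circuit is comparable to a free separator. If `C ⊆ A` and `e` is an element of
`cl C` outside `A`, then a circuit through `e` inside `C ∪ {e}` is not contained in `A`, so its
closure, and hence `cl C`, contains `A`. -/
theorem FreeSep.closure_subset_or [M.Finite] (hA : FreeSep M A) {C : Set α} (hC : M.IsCircuit C) :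
    M.closure C ⊆ A ∨ A ⊆ M.closure C := by
  have hA' := (freeSep_iff_isCircuit hA.1).1 hA
  refine (hA' C hC).elim (fun hCA => ?_) Or.inr
  by_contra! hcon
  obtain ⟨e, heC, heA⟩ := Set.not_subset.1 hcon.1
  obtain ⟨C', hC's, hC', heC'⟩ :=
    (Matroid.mem_closure_iff_exists_isCircuit fun h => heA (hCA h)).1 heC
  refine hcon.2 (((hA' C' hC').resolve_left fun h => heA (h heC')).trans ?_)
  rw [← Matroid.closure_insert_eq_of_mem_closure heC]
  exact M.closure_subset_closure hC's

/-- If the closure of every circuit meeting `X` contains `X`, then the elements of `X` are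
interchangeable. -/
theorem indep_of_sdiff_eq [M.Finite] {X I J : Set α}
    (hX : ∀ C, M.IsCircuit C → Disjoint C X ∨ X ⊆ M.closure C) (hI : I ⊆ M.E) (hJ : M.Indep J)
    (hIJ : I \ X = J \ X) (hcard : I.ncard = J.ncard) : M.Indep I := by
  by_contra hdep
  obtain ⟨C, hCI, hC⟩ := ((M.not_indep_iff hI).1 hdep).exists_isCircuit_subset
  rcases hX C hC with h | h
  · have : C ⊆ J := fun x hx =>
      (hIJ.subset ⟨hCI hx, Set.disjoint_left.1 h hx⟩).1
    exact hC.dep.not_indep (hJ.subset this)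
  -- Here `J ⊆ cl I`, so `ρ(I) ≥ |J| = |I|` and `I` is independent after all.
  · have hJI : J ⊆ M.closure I := by
      intro x hx
      by_cases hxX : x ∈ X
      · exact M.closure_subset_closure hCI (h hxX)
      · exact M.subset_closure I hI (hIJ.superset ⟨hx, hxX⟩).1
    refine hdep (indep_of_ncard_le_rk M hI ?_)
    have h1 := M.eRk_mono hJI
    rw [M.eRk_closure_eq, ← coe_rk, ← coe_rk, rk_eq_ncard hJ, ← hcard] at h1
    exact_mod_cast h1

/-- Disjoint finite sets of the same cardinality are exchanged by an involution that fixes all other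
elements. -/
theorem exists_perm_image_eq {U Y : Set α} (hU : U.Finite) (hY : Y.Finite) (hUY : Disjoint U Y)
    (hcard : U.ncard = Y.ncard) :
    ∃ σ : Equiv.Perm α, σ '' U = Y ∧ ∀ x, x ∉ U → x ∉ Y → σ x = x := by
  classical
  obtain ⟨e⟩ : Nonempty (U ≃ Y) := by
    have := hU.to_subtype
    have := hY.to_subtype
    exact Finite.card_eq.1 (by simpa [Nat.card_coe_set_eq] using hcard)
  set f : α → α := fun x => if h : x ∈ U then e ⟨x, h⟩ else
    if h : x ∈ Y then e.symm ⟨x, h⟩ else x with hf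
  have hfU : ∀ x : U, f x = e x := fun x => by simp [hf]
  have hfY : ∀ y : Y, f y = e.symm y := fun y => by
    simp [hf, Set.disjoint_right.1 hUY y.2]
  have hf0 : ∀ x, x ∉ U → x ∉ Y → f x = x := fun x h1 h2 => by simp [hf, h1, h2]
  have hinv : Function.Involutive f := by
    intro x
    by_cases hxU : x ∈ U
    · rw [hfU ⟨x, hxU⟩, hfY, Equiv.symm_apply_apply]
    · by_cases hxY : x ∈ Y
      · rw [hfY ⟨x, hxY⟩, hfU, Equiv.apply_symm_apply]
      · rw [hf0 x hxU hxY, hf0 x hxU hxY]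
  refine ⟨hinv.toPerm f, ?_, hf0⟩
  ext y
  constructor
  · rintro ⟨x, hx, rfl⟩
    change f x ∈ Y
    rw [hfU ⟨x, hx⟩]
    exact (e ⟨x, hx⟩).2
  · intro hy
    refine ⟨f y, ?_, hinv y⟩
    rw [hfY ⟨y, hy⟩]
    exact (e.symm ⟨y, hy⟩).2

/-- Given two free separators, an automorphism of the matroid carries the smaller one into the
larger one. If they are incomparable, the closure of a circuit is contained in their
intersection or contains their union, so the elements of the symmetric difference are
interchangeable. -/
theorem FreeSep.exists_subset [M.Finite] (hA : FreeSep M A) (hB : FreeSep M B)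
    (hcard : B.ncard ≤ A.ncard) :
    ∃ B' ⊆ A, FreeSep M B' ∧ Iso (M ↾ B') (M ↾ B) ∧ Iso (M ／ B') (M ／ B) := by
  have hAf := M.ground_finite.subset hA.1
  have hBf := M.ground_finite.subset hB.1
  by_cases hBA : B ⊆ A
  · exact ⟨B, hBA, hB, Iso.refl _, Iso.refl _⟩
  have hAB : ¬ A ⊆ B := fun h => hBA (Set.eq_of_subset_of_ncard_le h hcard hBf).superset
  have hcard' : (B \ A).ncard ≤ (A \ B).ncard := by
    have h1 := Set.ncard_inter_add_ncard_sdiff_eq_ncard A B hAf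
    have h2 := Set.ncard_inter_add_ncard_sdiff_eq_ncard B A hBf
    rw [Set.inter_comm] at h2
    omega
  obtain ⟨Y, hY, hYcard⟩ := Set.exists_subset_card_eq hcard'
  have hYf : Y.Finite := hAf.subset (hY.trans Set.sdiff_subset)
  obtain ⟨σ, hσ, hσ0⟩ := exists_perm_image_eq (hBf.sdiff (t := A)) hYf
    (Set.disjoint_left.2 fun x h1 h2 => h1.2 (hY h2).1) hYcard.symm
  -- The mixed cases are impossible because `A` and `B` are incomparable.
  have hX : ∀ C, M.IsCircuit C →
      Disjoint C ((A \ B) ∪ (B \ A)) ∨ (A \ B) ∪ (B \ A) ⊆ M.closure C := by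
    intro C hC
    have hCcl := M.subset_closure C hC.subset_ground
    rcases hA.closure_subset_or hC with h1 | h1 <;> rcases hB.closure_subset_or hC with h2 | h2
    · refine Or.inl (Set.disjoint_left.2 ?_)
      rintro x hx (h | h)
      exacts [h.2 (h2 (hCcl hx)), h.2 (h1 (hCcl hx))]
    · exact absurd (h2.trans h1) hBA
    · exact absurd (h1.trans h2) hAB
    · exact Or.inr (Set.union_subset (Set.sdiff_subset.trans h1) (Set.sdiff_subset.trans h2))
  have hσX : ∀ x, x ∉ (A \ B) ∪ (B \ A) → σ x = x := fun x hx =>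
    hσ0 x (fun h => hx (Or.inr h)) (fun h => hx (Or.inl (hY h)))
  have hσX' : ∀ x, σ x ∉ (A \ B) ∪ (B \ A) → σ x = x := fun x hx => σ.injective (hσX _ hx)
  have hXE : (A \ B) ∪ (B \ A) ⊆ M.E :=
    Set.union_subset (Set.sdiff_subset.trans hA.1) (Set.sdiff_subset.trans hB.1)
  have hσE : σ '' M.E = M.E := by
    have key : σ '' M.E ⊆ M.E := by
      rintro _ ⟨x, hx, rfl⟩
      by_cases h : σ x ∈ (A \ B) ∪ (B \ A)
      · exact hXE h
      · rwa [hσX' x h]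
    exact Set.eq_of_subset_of_ncard_le key
      (Set.ncard_image_of_injective _ σ.injective).ge M.ground_finite
  have hsd : ∀ I : Set α, σ '' I \ ((A \ B) ∪ (B \ A)) = I \ ((A \ B) ∪ (B \ A)) := by
    intro I
    ext x
    constructor
    · rintro ⟨⟨y, hy, rfl⟩, h⟩
      have h' := h
      rw [hσX' y h] at h' ⊢
      exact ⟨hy, h'⟩
    · rintro ⟨hx, h⟩
      exact ⟨⟨x, hx, hσX x h⟩, h⟩
  -- `σ` moves only elements of the symmetric difference, so it is an automorphism of `M`.
  have hmap : M.map σ σ.injective.injOn = M := by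
    refine Matroid.ext_indep hσE fun J hJ => ?_
    obtain ⟨I, hI, rfl⟩ := Set.subset_image_iff.1 (show J ⊆ σ '' M.E from hJ)
    rw [Matroid.map_image_indep_iff hI]
    have hc := Set.ncard_image_of_injective I σ.injective
    exact ⟨fun h => indep_of_sdiff_eq hX (hσE ▸ hJ) h (hsd I) hc,
      fun h => indep_of_sdiff_eq hX hI h (hsd I).symm hc.symm⟩
  refine ⟨σ '' B, ?_, ?_, ?_, ?_⟩
  · rintro _ ⟨x, hx, rfl⟩
    by_cases hxA : x ∈ A
    · have : σ x = x := hσ0 x (fun h => h.2 hxA) (fun h => (hY h).2 hx)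
      rwa [this]
    · exact (hY (hσ.subset ⟨x, ⟨hx, hxA⟩, rfl⟩)).1
  · have := (freeSep_map_iff (L := M) σ.injective).2 hB
    rwa [hmap] at this
  · have := map_restrict M σ σ.injective.injOn hB.1
    rw [hmap] at this
    rw [this]
    exact (iso_map _ _ _).symm
  · have := map_contract M σ σ.injective.injOn hB.1
    rw [hmap] at this
    rw [this]
    exact (iso_map _ _ _).symm

end Refinement

/-! ### Unique factorization of matroids -/

section Monoid

/-- The product of isomorphism classes induced by the free product of matroids. -/
instance : Mul MatroidClass.{u} :=
  ⟨Quotient.map₂ FinMatroid.freeProd fun _ _ h _ _ h' => Iso.freeProduct h h'⟩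

/-- The unit is the class of the empty matroid. -/
instance : One MatroidClass.{u} := ⟨FinMatroid.empty.cls⟩

theorem FinMatroid.cls_freeProd (M N : FinMatroid.{u}) : (M.freeProd N).cls = M.cls * N.cls := rfl

theorem FinMatroid.cls_eq_one_iff {M : FinMatroid.{u}} : M.cls = 1 ↔ M.E = ∅ :=
  FinMatroid.cls_eq_empty_iff

/-- The factorizations of the class of `M` are given by the free separators of `M`. -/
theorem FinMatroid.cls_eq_mul_iff {M : FinMatroid.{u}} {p q : MatroidClass.{u}} :
    M.cls = p * q ↔ ∃ A : 𝒫 M.E, FreeSep M.matroid A ∧ (M.restrict A).cls = p ∧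
      (M.contract A).cls = q := by
  obtain ⟨P, rfl⟩ : ∃ P : FinMatroid.{u}, P.cls = p := ⟨_, p.repr_cls⟩
  obtain ⟨Q, rfl⟩ : ∃ Q : FinMatroid.{u}, Q.cls = q := ⟨_, q.repr_cls⟩
  rw [← FinMatroid.cls_freeProd, FinMatroid.cls_eq_iff]
  refine iso_freeProduct_iff.trans ⟨?_, ?_⟩
  · rintro ⟨A, hA, h1, h2⟩
    exact ⟨⟨A, hA.1⟩, hA, FinMatroid.cls_eq_iff.2 h1, FinMatroid.cls_eq_iff.2 h2⟩
  · rintro ⟨A, hA, h1, h2⟩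
    exact ⟨A, hA, FinMatroid.cls_eq_iff.1 h1, FinMatroid.cls_eq_iff.1 h2⟩

/-- Associativity holds because a free separator of `M|B`, for a free separator `B` of `M`, is a free
separator of `M`, and `B \ A` is one of `M/A`. -/
instance : Monoid MatroidClass.{u} where
  mul_assoc p q r := by
    obtain ⟨M, hM⟩ : ∃ M : FinMatroid.{u}, M.cls = p * q * r := ⟨_, MatroidClass.repr_cls _⟩
    obtain ⟨⟨B, hB⟩, hBsep, h1, h2⟩ := FinMatroid.cls_eq_mul_iff.1 hM
    obtain ⟨⟨A, hA⟩, hAsep, h3, h4⟩ := FinMatroid.cls_eq_mul_iff.1 h1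
    have hAB : A ⊆ B := hA
    rw [restrict_restrict M hB hAB] at h3
    rw [restrict_contract M hB hAB] at h4
    rw [contract_contract M hB hAB] at h2
    rw [← hM]
    refine FinMatroid.cls_eq_mul_iff.2 ⟨⟨A, hAB.trans hB⟩, hBsep.of_restrict hAsep, h3, ?_⟩
    exact FinMatroid.cls_eq_mul_iff.2
      ⟨⟨(B \ A : Set M.carrier), Set.sdiff_subset_sdiff_left hB⟩, hBsep.contract A, h4, h2⟩
  one_mul p := by
    obtain ⟨M, rfl⟩ : ∃ M : FinMatroid.{u}, M.cls = p := ⟨_, p.repr_cls⟩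
    refine (FinMatroid.cls_eq_mul_iff.2
      ⟨⟨∅, Set.mem_powerset (Set.empty_subset _)⟩, ⟨Set.empty_subset _, ?_⟩, ?_, ?_⟩).symm
    · intro I hI _ hle
      rw [Set.union_empty] at hle
      exact indep_of_ncard_le_rk _ hI hle
    · exact FinMatroid.cls_eq_one_iff.2 rfl
    · rw [contract_empty]
  mul_one p := by
    obtain ⟨M, rfl⟩ : ∃ M : FinMatroid.{u}, M.cls = p := ⟨_, p.repr_cls⟩
    refine (FinMatroid.cls_eq_mul_iff.2
      ⟨⟨M.E, Set.mem_powerset subset_rfl⟩, ⟨subset_rfl, ?_⟩, ?_, ?_⟩).symm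
    · intro I hI hIE _
      rwa [Set.inter_eq_self_of_subset_left hI] at hIE
    · rw [restrict_ground]
    · exact FinMatroid.cls_eq_one_iff.2 Set.sdiff_self

/-- The number of elements of a matroid. -/
noncomputable def MatroidClass.size (c : MatroidClass.{u}) : ℕ := c.rank + c.nullity

theorem FinMatroid.size_cls (M : FinMatroid.{u}) : M.cls.size = M.E.ncard :=
  Nat.add_sub_cancel' (rk_le_ncard M.matroid M.matroid.ground_finite)

theorem MatroidClass.eq_one_of_size_eq_zero {c : MatroidClass.{u}} (h : c.size = 0) : c = 1 := by
  obtain ⟨M, rfl⟩ : ∃ M : FinMatroid.{u}, M.cls = c := ⟨_, c.repr_cls⟩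
  rw [FinMatroid.size_cls, Set.ncard_eq_zero M.matroid.ground_finite] at h
  exact FinMatroid.cls_eq_one_iff.2 h

theorem MatroidClass.size_mul (p q : MatroidClass.{u}) : (p * q).size = p.size + q.size := by
  obtain ⟨M, hM⟩ : ∃ M : FinMatroid.{u}, M.cls = p * q := ⟨_, MatroidClass.repr_cls _⟩
  obtain ⟨A, -, rfl, rfl⟩ := FinMatroid.cls_eq_mul_iff.1 hM
  rw [← hM, FinMatroid.size_cls, FinMatroid.size_cls, FinMatroid.size_cls, add_comm]
  exact (Set.ncard_sdiff_add_ncard_of_subset A.2 M.matroid.ground_finite).symm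

/-- Two factorizations of a matroid have a common refinement: the two free separators can be
taken to be nested. -/
theorem MatroidClass.exists_refinement (p q r s : MatroidClass.{u}) (h : p * q = r * s)
    (hle : r.size ≤ p.size) : ∃ t, p = r * t ∧ s = t * q := by
  obtain ⟨M, hM⟩ : ∃ M : FinMatroid.{u}, M.cls = p * q := ⟨_, MatroidClass.repr_cls _⟩
  obtain ⟨⟨A, hA⟩, hAsep, rfl, rfl⟩ := FinMatroid.cls_eq_mul_iff.1 hM
  obtain ⟨⟨B, hB⟩, hBsep, rfl, rfl⟩ := FinMatroid.cls_eq_mul_iff.1 (hM.trans h)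
  rw [FinMatroid.size_cls, FinMatroid.size_cls] at hle
  obtain ⟨B', hB', hB'sep, h1, h2⟩ := hAsep.exists_subset hBsep hle
  have h1' : (M.restrict ⟨B', hB'.trans hA⟩).cls = (M.restrict ⟨B, hB⟩).cls :=
    FinMatroid.cls_eq_iff.2 h1
  have h2' : (M.contract ⟨B', hB'.trans hA⟩).cls = (M.contract ⟨B, hB⟩).cls :=
    FinMatroid.cls_eq_iff.2 h2
  refine ⟨((M.restrict ⟨A, hA⟩).contract ⟨B', hB'⟩).cls, ?_, ?_⟩
  · refine FinMatroid.cls_eq_mul_iff.2 ⟨⟨B', hB'⟩, hB'sep.restrict hB' hA, ?_, rfl⟩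
    rw [restrict_restrict M hA hB', h1']
  · rw [← h2', restrict_contract M hA hB', contract_contract M hA hB']
    exact FinMatroid.cls_eq_mul_iff.2
      ⟨⟨(A \ B' : Set M.carrier), Set.sdiff_subset_sdiff_left hA⟩, hAsep.contract B', rfl, rfl⟩

theorem MatroidClass.IsIrreducible.eq_or_eq {c p q : MatroidClass.{u}} (hc : c.IsIrreducible)
    (h : c = p * q) : c = p ∨ c = q := by
  have := hc.2 p.repr q.repr (by rw [FinMatroid.cls_freeProd, repr_cls, repr_cls, h])
  rwa [repr_cls, repr_cls] at this

variable {𝓜 : Set MatroidClass.{u}}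

theorem MinorClosed.one_mem (h : MinorClosed 𝓜) (hne : 𝓜.Nonempty) : 1 ∈ 𝓜 := by
  obtain ⟨c, hc⟩ := hne
  rw [← c.repr_cls] at hc
  have := h.restrict hc ⟨∅, Set.mem_powerset (Set.empty_subset _)⟩
  rwa [FinMatroid.cls_eq_one_iff.2 rfl] at this

theorem FreeProductClosed.mul_mem (h : FreeProductClosed 𝓜) {p q : MatroidClass.{u}}
    (hp : p ∈ 𝓜) (hq : q ∈ 𝓜) : p * q ∈ 𝓜 := by
  rw [← p.repr_cls] at hp ⊢
  rw [← q.repr_cls] at hq ⊢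
  exact h _ _ hp hq

theorem MinorClosed.mem_of_mul_mem (h : MinorClosed 𝓜) {p q : MatroidClass.{u}}
    (hpq : p * q ∈ 𝓜) : p ∈ 𝓜 ∧ q ∈ 𝓜 := by
  obtain ⟨M, hM⟩ : ∃ M : FinMatroid.{u}, M.cls = p * q := ⟨_, MatroidClass.repr_cls _⟩
  obtain ⟨A, -, rfl, rfl⟩ := FinMatroid.cls_eq_mul_iff.1 hM
  rw [← hM] at hpq
  exact ⟨h.restrict hpq A, h.contract hpq A⟩

/-- The irreducible isomorphism classes in a family. -/
abbrev Irr (𝓜 : Set MatroidClass.{u}) : Type (u + 1) :=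
  {c : 𝓜 // MatroidClass.IsIrreducible (c : MatroidClass.{u})}

/-- The free product of a word of irreducible classes. -/
def wordClass (𝓜 : Set MatroidClass.{u}) : FreeMonoid (Irr 𝓜) →* MatroidClass.{u} :=
  FreeMonoid.lift fun c => ((c : 𝓜) : MatroidClass.{u})

theorem wordClass_of_mul (c : Irr 𝓜) (w : FreeMonoid (Irr 𝓜)) :
    wordClass 𝓜 (FreeMonoid.of c * w) = ((c : 𝓜) : MatroidClass.{u}) * wordClass 𝓜 w := by
  rw [map_mul, wordClass, FreeMonoid.lift_eval_of]

theorem wordClass_mem (h : MinorClosed 𝓜) (hne : 𝓜.Nonempty) (hfree : FreeProductClosed 𝓜)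
    (w : FreeMonoid (Irr 𝓜)) : wordClass 𝓜 w ∈ 𝓜 := by
  induction w using FreeMonoid.recOn with
  | one => rw [map_one]; exact h.one_mem hne
  | of_mul c w ih => rw [wordClass_of_mul]; exact hfree.mul_mem c.1.2 ih

theorem wordClass_injective : Function.Injective (wordClass 𝓜) :=
  injective_lift_of_refinement MatroidClass.size MatroidClass.size_mul
    (fun _ => MatroidClass.eq_one_of_size_eq_zero) MatroidClass.exists_refinement _
    (Subtype.val_injective.comp Subtype.val_injective) (fun c => c.2.1)
    (fun c _ _ h => c.2.eq_or_eq h)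

/-- Factors of a member of the family are minors of it, so they belong to the family. -/
theorem exists_wordClass_eq (h : MinorClosed 𝓜) {c : MatroidClass.{u}} (hc : c ∈ 𝓜) :
    ∃ w, wordClass 𝓜 w = c := by
  induction hn : c.size using Nat.strong_induction_on generalizing c with
  | _ n ih =>
    by_cases h1 : c = 1
    · exact ⟨1, by rw [map_one, h1]⟩
    by_cases hirr : c.IsIrreducible
    · exact ⟨FreeMonoid.of ⟨⟨c, hc⟩, hirr⟩, FreeMonoid.lift_eval_of _ _⟩
    obtain ⟨P, Q, hPQ, hP, hQ⟩ : ∃ P Q : FinMatroid.{u}, c = (P.freeProd Q).cls ∧ c ≠ P.cls ∧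
        c ≠ Q.cls := by
      by_contra! hcon
      exact hirr ⟨h1, fun P Q hPQ => or_iff_not_imp_left.2 (hcon P Q hPQ)⟩
    rw [FinMatroid.cls_freeProd] at hPQ
    have hsize := MatroidClass.size_mul P.cls Q.cls
    rw [← hPQ, hn] at hsize
    have hP0 : P.cls.size ≠ 0 := fun h0 => hQ (by
      rw [hPQ, MatroidClass.eq_one_of_size_eq_zero h0, one_mul])
    have hQ0 : Q.cls.size ≠ 0 := fun h0 => hP (by
      rw [hPQ, MatroidClass.eq_one_of_size_eq_zero h0, mul_one])
    obtain ⟨hPm, hQm⟩ := h.mem_of_mul_mem (hPQ ▸ hc)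
    obtain ⟨w, hw⟩ := ih _ (by omega) hPm rfl
    obtain ⟨w', hw'⟩ := ih _ (by omega) hQm rfl
    exact ⟨w * w', by rw [map_mul, hw, hw', hPQ]⟩

/-- Unique factorization: words of irreducible classes correspond to the classes in the
family. -/
noncomputable def wordEquiv (h : MinorClosed 𝓜) (hne : 𝓜.Nonempty) (hfree : FreeProductClosed 𝓜) :
    FreeMonoid (Irr 𝓜) ≃ 𝓜 :=
  Equiv.ofBijective (fun w => ⟨wordClass 𝓜 w, wordClass_mem h hne hfree w⟩)
    ⟨fun _ _ hw => wordClass_injective (congrArg Subtype.val hw),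
      fun c => (exists_wordClass_eq h c.2).imp fun _ hw => Subtype.ext hw⟩

end Monoid

/-! ### The weak order -/

section WeakOrder

variable {α : Type u} {β : Type v} {γ : Type w}

/-- The weak order: after a bijection of the ground sets, every independent set of `M` is
independent in `N`. The bijection is encoded by an isomorphic copy of `N` on the ground set
of `M`. -/
def WeakLE (M : Matroid α) (N : Matroid β) : Prop :=
  ∃ N' : Matroid α, Iso N' N ∧ N'.E = M.E ∧ ∀ I, M.Indep I → N'.Indep I

theorem WeakLE.trans_iso {M : Matroid α} {N : Matroid β} {L : Matroid γ} (h : WeakLE M N)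
    (h' : Iso N L) : WeakLE M L := by
  obtain ⟨N', h1, h2⟩ := h
  exact ⟨N', h1.trans h', h2⟩

theorem rk_le_rk_of_indep {M N : Matroid α} [M.Finite] [N.Finite]
    (h : ∀ I, M.Indep I → N.Indep I) (X : Set α) : rk M X ≤ rk N X := by
  have : M.eRk X ≤ N.eRk X :=
    Matroid.eRk_le_iff.2 fun I hIX hI => (h I hI).encard_le_eRk_of_subset hIX
  rw [← coe_rk, ← coe_rk] at this
  exact_mod_cast this

/-- The free product of `L|A` with any matroid above `L/A` is above `L`; in particular
`L ≤ L|A □ L/A`. -/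
theorem weakLE_freeProduct {L : Matroid α} {C : Matroid β} {D : Matroid γ} [L.Finite] [C.Finite]
    [D.Finite] {A : Set α} (hA : A ⊆ L.E) (hC : Iso (L ↾ A) C) (hD : WeakLE (L ／ A) D) :
    WeakLE L (freeProduct C D) := by
  obtain ⟨D', hDD', hE, hle⟩ := hD
  have := restrict_finite L hA
  have : D'.Finite := ⟨hE ▸ (L ／ A).ground_finite⟩
  have hE' : (freeProduct (L ↾ A) D').E = (freeProduct (L ↾ A) (L ／ A)).E := by
    rw [freeProduct_ground, freeProduct_ground, hE]
  have hinj : Set.InjOn (Sum.elim id id) (freeProduct (L ↾ A) D').E := hE' ▸ injOn_elim_id L A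
  have hground : Sum.elim id id '' (freeProduct (L ↾ A) D').E = L.E := by
    have := elim_id_image L.E A
    rw [Set.inter_eq_self_of_subset_right hA] at this
    rw [hE']
    exact this
  refine ⟨(freeProduct (L ↾ A) D').map (Sum.elim id id) hinj,
    (iso_map _ _ _).symm.trans (hC.freeProduct hDD'), hground, fun I hI => ?_⟩
  have h1 := (freeProduct_restrict_contract_indep_iff L hA hI.subset_ground).2
    ⟨hI.subset Set.inter_subset_left, ncard_le_rk_union hI A⟩
  rw [← elim_id_image I A]
  rw [Matroid.map_image_indep_iff (h1.subset_ground.trans hE'.superset)]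
  rw [freeProduct_indep, freeIndep_iff] at h1 ⊢
  exact ⟨h1.1.trans hE'.superset, h1.2.1,
    h1.2.2.trans (Nat.add_le_add_left (rk_le_rk_of_indep hle _) _)⟩

/-- The number of independent sets. -/
noncomputable def indepCount (M : Matroid α) : ℕ := {I | M.Indep I}.ncard

theorem indepCount_map (L : Matroid γ) {g : γ → α} (hg : g.Injective) :
    indepCount (L.map g hg.injOn) = indepCount L := by
  rw [indepCount, indepCount, ← Set.ncard_image_of_injective _ hg.image_injective]
  congr 1
  ext I
  simp only [Matroid.map_indep_iff, Set.mem_ofPred_eq, Set.mem_image, eq_comm]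

theorem Iso.indepCount_eq {M : Matroid α} {N : Matroid β} (h : Iso M N) :
    indepCount M = indepCount N := by
  obtain ⟨γ, L, g, k, hg, hk, rfl, rfl⟩ := h.exists_common
  rw [indepCount_map L hg, indepCount_map L hk]

theorem WeakLE.iso_or_indepCount_lt {M : Matroid α} {N : Matroid β} [M.Finite] (h : WeakLE M N) :
    Iso M N ∨ indepCount M < indepCount N := by
  obtain ⟨N', h1, hE, h2⟩ := h
  have hfin : {I | N'.Indep I}.Finite :=
    (M.ground_finite.finite_subsets).subset fun I hI => hE ▸ Matroid.Indep.subset_ground hI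
  rw [← h1.indepCount_eq]
  refine (lt_or_ge (indepCount M) (indepCount N')).symm.imp_left fun hle => ?_
  have heq : {I | M.Indep I} = {I | N'.Indep I} := Set.eq_of_subset_of_ncard_le h2 hle hfin
  have : M = N' := Matroid.ext_indep hE.symm fun I _ => Set.ext_iff.1 heq I
  exact this ▸ h1

end WeakOrder

/-! ### Finiteness of the number of matroids of a given size -/

section Finiteness

instance finite_matroid (α : Type u) [Finite α] : Finite (Matroid α) :=
  Finite.of_injective (fun M : Matroid α => (M.E, {I | M.Indep I})) fun M N h => by
    rw [Prod.mk.injEq] at h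
    exact Matroid.ext_indep h.1 fun I _ => Set.ext_iff.1 h.2 I

theorem finite_setOf_size_eq (n : ℕ) : {c : MatroidClass.{u} | c.size = n}.Finite := by
  refine (Set.finite_range fun N : Matroid (ULift.{u} (Fin n)) =>
    (FinMatroid.mk _ N ⟨Set.toFinite _⟩).cls).subset ?_
  intro c hc
  obtain ⟨M, rfl⟩ : ∃ M : FinMatroid.{u}, M.cls = c := ⟨_, c.repr_cls⟩
  have hn : M.E.ncard = n := M.size_cls.symm.trans hc
  have hfin : Finite M.E := M.matroid.ground_finite.to_subtype
  obtain ⟨e⟩ : Nonempty (M.E ≃ ULift.{u} (Fin n)) :=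
    Finite.card_eq.1 (by simp [Nat.card_coe_set_eq, hn])
  refine ⟨(M.matroid.restrictSubtype M.E).map e e.injective.injOn, FinMatroid.cls_eq_iff.2 ?_⟩
  have h := iso_map_map (M.matroid.restrictSubtype M.E) e.injective.injOn
    (Subtype.val_injective (p := (· ∈ M.E))).injOn
  rwa [Matroid.map_val_restrictSubtype_ground_eq] at h

end Finiteness

/-! ### Products of words in the minor algebra -/

section MinorAlgebra

variable (K : Type v) [Field K] {𝓜 : Set MatroidClass.{u}} (h : MinorClosed 𝓜)

/-- The value of an element of the minor algebra at an isomorphism class. -/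
noncomputable def coeff (f : minorAlgebra K h) (c : 𝓜) : K := f.1.ofConv (vec K h c)

theorem coeff_dualVec [DecidableEq 𝓜] (c c' : 𝓜) :
    coeff K h (dualVec K h c) c' = if c = c' then 1 else 0 := by
  refine (lin_vec K h _ _).trans ?_
  congr

theorem coeff_mul (f g : minorAlgebra K h) (M : FinMatroid.{u}) (hM : M.cls ∈ 𝓜) :
    coeff K h (f * g) ⟨M.cls, hM⟩ = ∑ A : 𝒫 M.E,
      coeff K h f ⟨(M.restrict A).cls, h.restrict hM A⟩ *
        coeff K h g ⟨(M.contract A).cls, h.contract hM A⟩ := by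
  change LinearMap.mul' K K (TensorProduct.map f.1.ofConv g.1.ofConv
      (CoalgebraStruct.comul (vec K h ⟨M.cls, hM⟩))) = _
  rw [comul_vec, map_sum, map_sum]
  rfl

theorem coeff_one (M : FinMatroid.{u}) (hM : M.cls ∈ 𝓜) [Decidable (M.E = ∅)] :
    coeff K h 1 ⟨M.cls, hM⟩ = if M.E = ∅ then 1 else 0 := by
  refine (counit_vec K h M hM).trans ?_
  congr

/-- A functional in the graded dual is nonzero in finitely many bidegrees, and the classes of a given
bidegree all have the same size. -/
theorem finite_support_coeff (f : minorAlgebra K h) : (Function.support (coeff K h f)).Finite := by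
  have hf := f.2
  refine Set.Finite.of_finite_image ?_ Subtype.val_injective.injOn
  refine (hf.biUnion fun p _ => finite_setOf_size_eq.{u} (p.1 + p.2)).subset ?_
  rintro _ ⟨c, hc, rfl⟩
  simp only [Set.mem_iUnion]
  exact ⟨(c.1.rank, c.1.nullity), ⟨vec K h c, Submodule.subset_span ⟨c, rfl, rfl, rfl⟩, hc⟩, rfl⟩

/-- The coordinates of the minor algebra with respect to the dual basis. -/
noncomputable def coeffEquiv : minorAlgebra K h ≃ₗ[K] (𝓜 →₀ K) :=
  LinearEquiv.ofBijective
    { toFun := fun f => Finsupp.ofSupportFinite (coeff K h f) (finite_support_coeff K h f)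
      map_add' := fun _ _ => Finsupp.ext fun _ => rfl
      map_smul' := fun _ _ => Finsupp.ext fun _ => rfl } <| by
    classical
    constructor
    · intro f g hfg
      have hfg' : ∀ c, coeff K h f c = coeff K h g c := fun c => DFunLike.congr_fun hfg c
      refine Subtype.ext ?_
      have : f.1.ofConv = g.1.ofConv := lin_ext K h fun M hM => hfg' _
      exact WithConv.ofConv_injective this
    · refine LinearMap.range_eq_top.1 (eq_top_iff.2 ?_)
      intro s _
      rw [← Finsupp.sum_single s]
      refine Submodule.sum_mem _ fun c _ => ⟨s c • dualVec K h c, Finsupp.ext fun c' => ?_⟩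
      change s c * coeff K h (dualVec K h c) c' = _
      rw [coeff_dualVec, Finsupp.single_apply, mul_ite, mul_one, mul_zero]

theorem coeffEquiv_apply (f : minorAlgebra K h) (c : 𝓜) : coeffEquiv K h f c = coeff K h f c := rfl

/-- The product in the minor algebra of a word of irreducible classes. -/
noncomputable def wordProd : FreeMonoid (Irr 𝓜) →* minorAlgebra K h :=
  FreeMonoid.lift fun c => dualVec K h (c : 𝓜)

theorem coeff_dualVec_mul [DecidableEq MatroidClass.{u}] (x : 𝓜) (f : minorAlgebra K h)
    (M : FinMatroid.{u}) (hM : M.cls ∈ 𝓜) :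
    coeff K h (dualVec K h x * f) ⟨M.cls, hM⟩ = ∑ A : 𝒫 M.E,
      if x.1 = (M.restrict A).cls then coeff K h f ⟨(M.contract A).cls, h.contract hM A⟩
        else 0 := by
  classical
  rw [coeff_mul]
  refine Finset.sum_congr rfl fun A _ => ?_
  simp only [coeff_dualVec, ite_mul, one_mul, zero_mul, Subtype.ext_iff]

theorem wordProd_of_mul (x : Irr 𝓜) (w : FreeMonoid (Irr 𝓜)) :
    wordProd K h (FreeMonoid.of x * w) = dualVec K h (x : 𝓜) * wordProd K h w := by
  rw [map_mul, wordProd, FreeMonoid.lift_eval_of]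

theorem exists_eq_cls (c : 𝓜) : ∃ (M : FinMatroid.{u}) (hM : M.cls ∈ 𝓜), c = ⟨M.cls, hM⟩ :=
  ⟨c.1.repr, c.1.repr_cls.symm ▸ c.2, Subtype.ext c.1.repr_cls.symm⟩

/-- The coefficients count flags of subsets with prescribed successive minors, so they are natural
numbers. This excludes cancellation in the sum for `coeff_wordProd_wordClass_ne_zero`. -/
theorem exists_nat_coeff_wordProd_eq (w : FreeMonoid (Irr 𝓜)) (c : 𝓜) :
    ∃ n : ℕ, coeff K h (wordProd K h w) c = n := by
  classical
  induction w using FreeMonoid.recOn generalizing c with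
  | one =>
    obtain ⟨M, hM, rfl⟩ := exists_eq_cls c
    rw [map_one, coeff_one]
    exact ⟨if M.E = ∅ then 1 else 0, by push_cast; rfl⟩
  | of_mul x w ih =>
    obtain ⟨M, hM, rfl⟩ := exists_eq_cls c
    choose n hn using ih
    refine ⟨∑ A : 𝒫 M.E, if x.1.1 = (M.restrict A).cls then
      n ⟨(M.contract A).cls, h.contract hM A⟩ else 0, ?_⟩
    rw [wordProd_of_mul, coeff_dualVec_mul]
    push_cast
    simp only [hn]

/-- The matroids in the product of a word of irreducible classes lie below the free product of
the word in the weak order. -/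
theorem weakLE_of_coeff_wordProd_ne_zero (w : FreeMonoid (Irr 𝓜)) (L : FinMatroid.{u})
    (hL : L.cls ∈ 𝓜) (hne : coeff K h (wordProd K h w) ⟨L.cls, hL⟩ ≠ 0) :
    WeakLE L.matroid (wordClass 𝓜 w).repr.matroid := by
  classical
  induction w using FreeMonoid.recOn generalizing L with
  | one =>
    rw [map_one, coeff_one] at hne
    have h1 : L.E = ∅ := by by_contra h0; exact hne (if_neg h0)
    refine ⟨L.matroid, FinMatroid.cls_eq_iff.1 ?_, rfl, fun _ hI => hI⟩
    rw [MatroidClass.repr_cls, map_one, FinMatroid.cls_eq_one_iff.2 h1]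
  | of_mul x w ih =>
    rw [wordProd_of_mul, coeff_dualVec_mul] at hne
    obtain ⟨A, -, hA⟩ := Finset.exists_ne_zero_of_sum_ne_zero hne
    rw [ne_eq, ite_eq_right_iff, Classical.not_imp] at hA
    have hiso : Iso (L.restrict A).matroid x.1.1.repr.matroid :=
      FinMatroid.cls_eq_iff.1 (by rw [MatroidClass.repr_cls, hA.1])
    refine (weakLE_freeProduct A.2 hiso (ih _ _ hA.2)).trans_iso ?_
    refine (FinMatroid.cls_eq_iff (M := x.1.1.repr.freeProd (wordClass 𝓜 w).repr)
      (N := (wordClass 𝓜 (FreeMonoid.of x * w)).repr)).1 ?_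
    rw [FinMatroid.cls_freeProd]
    simp only [MatroidClass.repr_cls, wordClass_of_mul]

/-- The free product of a word occurs in the product of the word, its multiplicity being a positive
integer. -/
theorem coeff_wordProd_wordClass_ne_zero [CharZero K] (w : FreeMonoid (Irr 𝓜)) (c : 𝓜)
    (hw : c.1 = wordClass 𝓜 w) : coeff K h (wordProd K h w) c ≠ 0 := by
  classical
  obtain ⟨M, hM, rfl⟩ := exists_eq_cls c
  induction w using FreeMonoid.recOn generalizing M with
  | one =>
    have hw' : M.cls = 1 := hw
    rw [FinMatroid.cls_eq_one_iff] at hw'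
    rw [map_one, coeff_one, if_pos hw']
    exact one_ne_zero
  | of_mul x w ih =>
    rw [wordClass_of_mul] at hw
    obtain ⟨A, -, h1, h2⟩ := FinMatroid.cls_eq_mul_iff.1 hw
    choose n hn using exists_nat_coeff_wordProd_eq K h w
    have h3 := ih (M.contract A) (h.contract hM A) h2
    rw [wordProd_of_mul, coeff_dualVec_mul]
    simp only [hn] at h3 ⊢
    have hsum : (∑ A : 𝒫 M.E, if x.1.1 = (M.restrict A).cls then
        n ⟨(M.contract A).cls, h.contract hM A⟩ else 0) ≠ 0 := by
      intro h0
      have h4 := Finset.sum_eq_zero_iff.1 h0 A (Finset.mem_univ A)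
      rw [if_pos h1.symm] at h4
      exact h3 (by rw [h4, Nat.cast_zero])
    exact_mod_cast (Nat.cast_ne_zero (R := K)).2 hsum

/-- The level used for triangularity: the number of independent sets. -/
noncomputable def level (c : MatroidClass.{u}) : ℕ := indepCount c.repr.matroid

/-- Triangularity of the products of words. -/
theorem eq_or_level_lt (w : FreeMonoid (Irr 𝓜)) (c : 𝓜)
    (hne : coeff K h (wordProd K h w) c ≠ 0) :
    c.1 = wordClass 𝓜 w ∨ level c.1 < level (wordClass 𝓜 w) := by
  have hc : (⟨c.1.repr.cls, c.1.repr_cls.symm ▸ c.2⟩ : 𝓜) = c := Subtype.ext c.1.repr_cls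
  rw [← hc] at hne
  have := (weakLE_of_coeff_wordProd_ne_zero K h w _ _ hne).iso_or_indepCount_lt
  refine this.imp_left fun hiso => ?_
  have := FinMatroid.cls_eq_iff.2 hiso
  rwa [MatroidClass.repr_cls, MatroidClass.repr_cls] at this

end MinorAlgebra

end MatroidMinor

theorem mainTheorem9 (K : Type v) [Field K] [CharZero K]
    (𝓜 : Set MatroidMinor.MatroidClass.{u}) (hne : 𝓜.Nonempty)
    (hminor : MatroidMinor.MinorClosed 𝓜) (hfree : MatroidMinor.FreeProductClosed 𝓜) :
    Function.Bijective
      (FreeAlgebra.lift K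
        (fun c : {c : 𝓜 // MatroidMinor.MatroidClass.IsIrreducible (c : MatroidMinor.MatroidClass.{u})} =>
          MatroidMinor.dualVec K hminor (c : 𝓜)) :
        FreeAlgebra K
            {c : 𝓜 // MatroidMinor.MatroidClass.IsIrreducible (c : MatroidMinor.MatroidClass.{u})} →ₐ[K]
          MatroidMinor.minorAlgebra K hminor) := by
  open MatroidMinor in
  set φ := FreeAlgebra.lift K (fun c : Irr 𝓜 => dualVec K hminor (c : 𝓜)) with hφ
  set e := wordEquiv hminor hne hfree
  -- Coordinates with respect to the dual basis, indexed by words through unique factorization.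
  set ψ : minorAlgebra K hminor ≃ₗ[K] (FreeMonoid (Irr 𝓜) →₀ K) :=
    (coeffEquiv K hminor).trans (Finsupp.domLCongr e.symm) with hψ
  have hψ_apply : ∀ f w, ψ f w = coeff K hminor f (e w) := by
    intro f w
    rw [hψ, LinearEquiv.trans_apply, Finsupp.domLCongr_apply, Finsupp.domCongr_apply,
      Finsupp.equivMapDomain_apply, Equiv.symm_symm, coeffEquiv_apply]
  have hbij := bijective_linearCombination_of_triangular (K := K)
    (fun w => level (wordClass 𝓜 w)) (fun w => ψ (wordProd K hminor w))
    (fun w => by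
      rw [hψ_apply]
      exact coeff_wordProd_wordClass_ne_zero K hminor w _ rfl)
    (fun w w' h0 => by
      rw [hψ_apply] at h0
      exact (eq_or_level_lt K hminor w _ h0).imp_left fun h1 => wordClass_injective h1)
  set b := FreeAlgebra.basisFreeMonoid K (Irr 𝓜)
  have hb : ∀ w, φ (b w) = wordProd K hminor w := by
    intro w
    have hbw : b w = FreeMonoid.lift (FreeAlgebra.ι K) w := by
      simp [b, FreeAlgebra.basisFreeMonoid, FreeAlgebra.equivMonoidAlgebraFreeMonoid]
    have hmon : (φ : _ →* _).comp (FreeMonoid.lift (FreeAlgebra.ι K)) = wordProd K hminor :=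
      FreeMonoid.hom_eq fun x => by simp [hφ, wordProd]
    rw [hbw, ← hmon]
    rfl
  have hcomp : Finsupp.linearCombination K (fun w => ψ (wordProd K hminor w)) =
      ψ.toLinearMap ∘ₗ φ.toLinearMap ∘ₗ b.repr.symm.toLinearMap := by
    refine Finsupp.lhom_ext' fun w => LinearMap.ext_ring ?_
    simp [hb]
  have hfun : ⇑φ = ψ.symm ∘ Finsupp.linearCombination K (fun w => ψ (wordProd K hminor w)) ∘
      b.repr := by
    funext x
    simp [hcomp]
  rw [hfun]
  exact ψ.symm.bijective.comp (hbij.comp b.repr.bijective)
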